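/- Let $n\in\mathbb N$, $T>0$, and let $A:\mathbb R\to\mathbb R^{n\times n}$ be continuous and $T$-periodic. A fundamental matrix solution of the linear system $$\dot{\mathbf x}=A(t)\,\mathbf x,\qquad \mathbf x\in\mathbb R^n, \tag{1}$$ is a differentiable $\Phi:\mathbb R\to\mathbb R^{n\times n}$ with $\dot\Phi(t)=A(t)\Phi(t)$ and $\Phi(t)$ nonsingular for all $t\in\mathbb R$; the matrix $\Phi(0)^{-1}\Phi(T)$ is then called a monodromy matrix of (1), and its (complex) Jordan normal form does not depend on the choice of $\Phi$, up to the order of the blocks. The antiperiodicity index (A-index) of (1) is the sum of the dimensions of the Jordan blocks associated to a real negative eigenvalue that appear an odd number of times (each one counted only once) in the Jordan normal form of a monodromy matrix of (1). Let $d$ be the A-index of (1). Then $d\le n$, and there are $R\in\mathbb R^{n\times n}$ and $Q:\mathbb R\to\mathbb R^{n\times n}$ such that $\Phi(t):=Q(t)e^{tR}$ is a fundamental matrix solution of (1) and $$Q(t+T)=Q(t)\,\bigl[I_{n-d}\oplus(-I_d)\bigr]\qquad\text{for all } t\in\mathbb R,$$ where $\oplus$ denotes the direct sum of square matrices. In particular,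 $Q(t)$ is nonsingular for all $t$ and the change of variables $\mathbf y=Q(t)^{-1}\mathbf x$ transforms (1) into the real linear system with constant coefficients $\dot{\mathbf y}=R\,\mathbf y$: for every $\mathbf x:\mathbb R\to\mathbb R^n$ and every $t\in\mathbb R$, $\mathbf x$ is differentiable at $t$ with $\dot{\mathbf x}(t)=A(t)\mathbf x(t)$ if and only if $\mathbf y:=Q^{-1}\mathbf x$ is differentiable at $t$ with $\dot{\mathbf y}(t)=R\,\mathbf y(t)$. -/

import Mathlib

namespace Floquet

/-- `Φ` is a fundamental matrix solution of the real linear system `x' = A(t) x`: a differentiable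
matrix function with `Φ'(t) = A(t) Φ(t)` whose value is nonsingular at every time. -/
def IsFundamentalMatrix {n : ℕ} (A Φ : ℝ → Matrix (Fin n) (Fin n) ℝ) : Prop :=
  (∀ t, HasDerivAt Φ (A t * Φ t) t) ∧ ∀ t, IsUnit (Φ t)

/-- The monodromy matrix `Φ(0)⁻¹ Φ(T)` of a fundamental matrix solution `Φ`. -/
noncomputable def monodromy {n : ℕ} (Φ : ℝ → Matrix (Fin n) (Fin n) ℝ) (T : ℝ) :
    Matrix (Fin n) (Fin n) ℝ :=
  (Φ 0)⁻¹ * Φ T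

/-- The `m × m` Jordan block with eigenvalue `lam`: `lam` on the diagonal, `1` on the
superdiagonal, `0` elsewhere. -/
noncomputable def jordanBlock (lam : ℂ) (m : ℕ) : Matrix (Fin m) (Fin m) ℂ :=
  Matrix.of fun i j => if i = j then lam else if (i : ℕ) + 1 = (j : ℕ) then 1 else 0

/-- The block diagonal matrix whose blocks are the Jordan blocks listed in `J`; an entry `(lam, m)`
of the list stands for the `m × m` Jordan block with eigenvalue `lam`. -/
noncomputable def jordanMatrix (J : List (ℂ × ℕ)) :
    Matrix (Σ i : Fin J.length, Fin (J.get i).2) (Σ i : Fin J.length, Fin (J.get i).2) ℂ :=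
  Matrix.blockDiagonal' fun i => jordanBlock (J.get i).1 (J.get i).2

/-- The list `J` of Jordan blocks (all of positive size) is a Jordan normal form of the complex
matrix `M`: after an identification of the index sets, `M` is similar over `ℂ` to the block
diagonal matrix with these blocks. -/
def IsJordanForm {n : ℕ} (M : Matrix (Fin n) (Fin n) ℂ) (J : List (ℂ × ℕ)) : Prop :=
  (∀ p ∈ J, 0 < p.2) ∧
    ∃ (e : (Σ i : Fin J.length, Fin (J.get i).2) ≃ Fin n) (P : Matrix (Fin n) (Fin n) ℂ),
      IsUnit P ∧ M = P * Matrix.reindex e e (jordanMatrix J) * P⁻¹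

/-- The sum of the dimensions of the Jordan blocks with a real negative eigenvalue that occur an
odd number of times in the list `J`, each such block being counted only once. -/
noncomputable def oddNegativeSize (J : List (ℂ × ℕ)) : ℕ :=
  ∑ p ∈ J.toFinset with (p.1.im = 0 ∧ p.1.re < 0) ∧ Odd (J.count p), p.2

/-- `d` is the sum of the dimensions of the Jordan blocks with a real negative eigenvalue that
occur an odd number of times (each counted once) in the Jordan normal form of a monodromy matrix
of the system `x' = A(t) x`. -/
def IsAIndex {n : ℕ} (A : ℝ → Matrix (Fin n) (Fin n) ℝ) (T : ℝ) (d : ℕ) : Prop :=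
  ∃ (Φ : ℝ → Matrix (Fin n) (Fin n) ℝ) (J : List (ℂ × ℕ)),
    IsFundamentalMatrix A Φ ∧
      IsJordanForm ((monodromy Φ T).map Complex.ofReal) J ∧ d = oddNegativeSize J

open Classical in
/-- The antiperiodicity index (A-index) of the `T`-periodic system `x' = A(t) x`: the number `d`
with `IsAIndex A T d`. All monodromy matrices of the system are similar and a Jordan normal form is
unique up to the order of its blocks, so there is only one such number. -/
noncomputable def aIndex {n : ℕ} (A : ℝ → Matrix (Fin n) (Fin n) ℝ) (T : ℝ) : ℕ :=
  if h : ∃ d, IsAIndex A T d then h.choose else 0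

/-- The direct sum `M ⊕ N` of two square matrices. -/
def directSum {p q : ℕ} (M : Matrix (Fin p) (Fin p) ℝ) (N : Matrix (Fin q) (Fin q) ℝ) :
    Matrix (Fin (p + q)) (Fin (p + q)) ℝ :=
  Matrix.reindex finSumFinEquiv finSumFinEquiv (Matrix.fromBlocks M 0 0 N)

/-- The `n × n` matrix `I_{n-d} ⊕ (-I_d)`, for `d ≤ n`. -/
def signMatrix {n d : ℕ} (hd : d ≤ n) : Matrix (Fin n) (Fin n) ℝ :=
  Matrix.reindex (finCongr (Nat.sub_add_cancel hd)) (finCongr (Nat.sub_add_cancel hd))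
    (directSum (1 : Matrix (Fin (n - d)) (Fin (n - d)) ℝ) (-1 : Matrix (Fin d) (Fin d) ℝ))

end Floquet

/-! If `Φ` is a fundamental matrix with monodromy `M`, then `Φ (t + T) = Φ t * M`, because `(Φ t)⁻¹
* Φ (t + T)` has zero derivative. Suppose `M * P = P * (S * exp R')` with `P` invertible and `S = I
⊕ -I` commuting with `R'`. Put `R = T⁻¹ • R'` and `Q t = Φ t * P * exp (-t R)`. Advancing by a
period inserts `S * exp R' * exp (-T R) = S`, and `S` commutes past the remaining exponential, so `Q
(t + T) = Q t * S`. Moreover `Q' = A Q - Q R`, which is what the change of variables needs.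

Everything thus rests on a real factorization of an invertible real matrix (`exists_signed_exp`),
read off from its complex Jordan blocks (`exists_realLog_decomposition`). A block with positive
eigenvalue is similar to a real exponential. Nonreal blocks occur in conjugate pairs
(`count_conjBlock`), and such a pair is the realification of a complex exponential
(`hasRealLog_pair`). The same construction applies to two equal negative blocks, a pair conjugate to
itself. What is left is one copy of each negative block of odd multiplicity; each is similar to
minus a real exponential, and their total size is the A-index. The resulting similarity over `ℂ`
descends to `ℝ` by `Sim.of_map_ofReal`.

The index is meaningful because fundamental matrices exist (Picard series) and so do Jordan forms
(`exists_isJordanForm`). -/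

open Matrix

namespace Floquet

/-! ### Similarity of matrices over arbitrary finite index types -/

section Similarity

variable {K : Type*} [Field K] {ι κ μ ν : Type*}
  [Fintype ι] [DecidableEq ι] [Fintype κ] [DecidableEq κ] [Fintype μ] [DecidableEq μ]
  [Fintype ν] [DecidableEq ν]

/-- Similarity of square matrices whose index types may differ. -/
def Sim (M : Matrix ι ι K) (N : Matrix κ κ K) : Prop :=
  ∃ (P : Matrix ι κ K) (Q : Matrix κ ι K), P * Q = 1 ∧ Q * P = 1 ∧ M * P = P * N

theorem Sim.refl (M : Matrix ι ι K) : Sim M M := ⟨1, 1, by simp, by simp, by simp⟩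

theorem Sim.symm {M : Matrix ι ι K} {N : Matrix κ κ K} (h : Sim M N) : Sim N M := by
  obtain ⟨P, Q, h1, h2, h3⟩ := h
  refine ⟨Q, P, h2, h1, ?_⟩
  calc N * Q = (Q * P) * N * Q := by rw [h2, Matrix.one_mul]
    _ = Q * (P * N) * Q := by simp only [Matrix.mul_assoc]
    _ = Q * M * (P * Q) := by rw [← h3]; simp only [Matrix.mul_assoc]
    _ = Q * M := by rw [h1, Matrix.mul_one]

theorem Sim.trans {M : Matrix ι ι K} {N : Matrix κ κ K} {L : Matrix μ μ K}
    (h : Sim M N) (h' : Sim N L) : Sim M L := by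
  obtain ⟨P, Q, h1, h2, h3⟩ := h
  obtain ⟨P', Q', h1', h2', h3'⟩ := h'
  refine ⟨P * P', Q' * Q, ?_, ?_, ?_⟩
  · calc P * P' * (Q' * Q) = P * (P' * Q') * Q := by simp only [Matrix.mul_assoc]
      _ = 1 := by rw [h1', Matrix.mul_one, h1]
  · calc Q' * Q * (P * P') = Q' * (Q * P) * P' := by simp only [Matrix.mul_assoc]
      _ = 1 := by rw [h2, Matrix.mul_one, h2']
  · rw [← Matrix.mul_assoc, h3, Matrix.mul_assoc, h3', Matrix.mul_assoc]

theorem Sim.submatrix (M : Matrix ι ι K) (e : κ ≃ ι) : Sim M (M.submatrix e e) := by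
  refine ⟨(1 : Matrix ι ι K).submatrix id e, (1 : Matrix ι ι K).submatrix e id, ?_, ?_, ?_⟩
  · rw [Matrix.submatrix_mul_equiv]; simp
  · rw [← Matrix.submatrix_mul _ _ e id e Function.bijective_id]; simp
  · have h1 : M * (1 : Matrix ι ι K).submatrix id e = (M * 1).submatrix id e :=
      (Matrix.submatrix_mul M 1 id id e Function.bijective_id).symm
    rw [h1, Matrix.submatrix_mul_equiv]; simp

theorem Sim.reindex (M : Matrix ι ι K) (e : ι ≃ κ) : Sim M (Matrix.reindex e e M) :=
  Sim.submatrix M e.symm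

theorem Sim.fromBlocks {A : Matrix ι ι K} {A' : Matrix κ κ K} {B : Matrix μ μ K}
    {B' : Matrix ν ν K} (h : Sim A A') (h' : Sim B B') :
    Sim (fromBlocks A 0 0 B) (fromBlocks A' 0 0 B') := by
  obtain ⟨P, Q, h1, h2, h3⟩ := h
  obtain ⟨P', Q', h1', h2', h3'⟩ := h'
  refine ⟨Matrix.fromBlocks P 0 0 P', Matrix.fromBlocks Q 0 0 Q', ?_, ?_, ?_⟩ <;>
    simp [fromBlocks_multiply, *]

theorem Sim.fromBlocks_comm (A : Matrix ι ι K) (B : Matrix κ κ K) :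
    Sim (Matrix.fromBlocks A 0 0 B) (Matrix.fromBlocks B 0 0 A) := by
  have := Sim.submatrix (Matrix.fromBlocks A 0 0 B) (Equiv.sumComm κ ι)
  simpa using this

theorem Sim.fromBlocks_assoc (A : Matrix ι ι K) (B : Matrix κ κ K) (C : Matrix μ μ K) :
    Sim (Matrix.fromBlocks (Matrix.fromBlocks A 0 0 B) 0 0 C)
      (Matrix.fromBlocks A 0 0 (Matrix.fromBlocks B 0 0 C)) := by
  have := Sim.submatrix (Matrix.fromBlocks (Matrix.fromBlocks A 0 0 B) 0 0 C)
    (Equiv.sumAssoc ι κ μ).symm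
  convert this using 1
  ext i j
  rcases i with i | i | i <;> rcases j with j | j | j <;> simp

theorem Sim.fromBlocks_of_isEmpty [IsEmpty ι] (A : Matrix ι ι K) (B : Matrix κ κ K) :
    Sim (Matrix.fromBlocks A 0 0 B) B := by
  have := Sim.submatrix (Matrix.fromBlocks A 0 0 B) (Equiv.emptySum ι κ).symm
  convert this using 1
  ext i j
  simp

theorem Sim.map {L : Type*} [Field L] (f : K →+* L) {M : Matrix ι ι K} {N : Matrix κ κ K}
    (h : Sim M N) : Sim (M.map f) (N.map f) := by
  obtain ⟨P, Q, h1, h2, h3⟩ := h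
  refine ⟨P.map f, Q.map f, ?_, ?_, ?_⟩
  · rw [← Matrix.map_mul, h1]; simp
  · rw [← Matrix.map_mul, h2]; simp
  · rw [← Matrix.map_mul, h3, Matrix.map_mul]

theorem Sim.sub_smul_one_pow {M : Matrix ι ι K} {N : Matrix κ κ K} (h : Sim M N) (c : K) (k : ℕ) :
    Sim ((M - c • 1) ^ k) ((N - c • 1) ^ k) := by
  obtain ⟨P, Q, h1, h2, h3⟩ := h
  refine ⟨P, Q, h1, h2, ?_⟩
  induction k with
  | zero => simp
  | succ k ih =>
    rw [pow_succ, Matrix.mul_assoc, Matrix.sub_mul, h3, smul_mul, Matrix.one_mul,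
      pow_succ, ← Matrix.mul_assoc P, ← ih, Matrix.mul_assoc, Matrix.mul_sub P, Matrix.mul_smul P,
      Matrix.mul_one]

theorem Sim.rank_eq {M : Matrix ι ι K} {N : Matrix κ κ K} (h : Sim M N) : M.rank = N.rank := by
  refine le_antisymm ?_ ?_
  · obtain ⟨P, Q, h1, h2, h3⟩ := h
    have : M = P * (N * Q) := by
      rw [← Matrix.mul_assoc, ← h3, Matrix.mul_assoc, h1, Matrix.mul_one]
    rw [this]
    exact (rank_mul_le_right _ _).trans (rank_mul_le_left _ _)
  · obtain ⟨P, Q, h1, h2, h3⟩ := h.symm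
    have : N = P * (M * Q) := by
      rw [← Matrix.mul_assoc, ← h3, Matrix.mul_assoc, h1, Matrix.mul_one]
    rw [this]
    exact (rank_mul_le_right _ _).trans (rank_mul_le_left _ _)

theorem Sim.card_eq {M : Matrix ι ι K} {N : Matrix κ κ K} (h : Sim M N) :
    Fintype.card ι = Fintype.card κ := by
  obtain ⟨P, Q, h1, h2, -⟩ := h
  exact Matrix.square_of_invertible Q P h2 h1 |>.symm

theorem Sim.isUnit {M : Matrix ι ι K} {N : Matrix κ κ K} (h : Sim M N) (hM : IsUnit M) :
    IsUnit N := by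
  obtain ⟨P, Q, h1, h2, h3⟩ := h
  rw [Matrix.isUnit_iff_isUnit_det] at hM
  refine IsUnit.of_mul_eq_one_right (Q * M⁻¹ * P) ?_
  calc Q * M⁻¹ * P * N = Q * M⁻¹ * (P * N) := by simp only [Matrix.mul_assoc]
    _ = Q * (M⁻¹ * M) * P := by rw [← h3]; simp only [Matrix.mul_assoc]
    _ = 1 := by rw [Matrix.nonsing_inv_mul _ hM, Matrix.mul_one, h2]

end Similarity

theorem rank_fromBlocks_diag {K ι κ μ ν : Type*} [Field K] [Fintype κ] [Fintype ν] [Finite ι]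
    [Finite μ] (A : Matrix ι κ K) (B : Matrix μ ν K) :
    (Matrix.fromBlocks A 0 0 B).rank = A.rank + B.rank := by
  have h : (Matrix.fromBlocks A 0 0 B).mulVecLin =
      (LinearEquiv.sumArrowLequivProdArrow ι μ K K).symm.toLinearMap ∘ₗ
        (A.mulVecLin.prodMap B.mulVecLin) ∘ₗ
        (LinearEquiv.sumArrowLequivProdArrow κ ν K K).toLinearMap := by
    refine LinearMap.ext fun v => ?_
    ext i
    rcases i with i | i <;> simp [Matrix.fromBlocks_mulVec, Function.comp_def,
      LinearEquiv.sumArrowLequivProdArrow, Equiv.sumArrowEquivProdArrow]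
  rw [Matrix.rank, h, LinearMap.range_comp, LinearEquiv.finrank_map_eq, LinearMap.range_comp,
    LinearEquiv.range, Submodule.map_top, LinearMap.range_prodMap]
  rw [Matrix.rank, Matrix.rank, ← Module.finrank_prod]
  let e : (A.mulVecLin.range.prod B.mulVecLin.range) ≃ₗ[K]
      (A.mulVecLin.range × B.mulVecLin.range) :=
    { toFun := fun x => (⟨x.1.1, x.2.1⟩, ⟨x.1.2, x.2.2⟩)
      invFun := fun x => ⟨(x.1.1, x.2.1), x.1.2, x.2.2⟩
      map_add' := fun _ _ => rfl
      map_smul' := fun _ _ => rfl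
      left_inv := fun _ => rfl
      right_inv := fun _ => rfl }
  exact e.finrank_eq

/-! ### Global solutions of linear equations by the Picard series -/

section LinearODE

variable {𝔸 : Type*} [NormedRing 𝔸] [NormedAlgebra ℝ 𝔸]

/-- The terms of the Picard series of the linear equation `x' = A(t) x`. -/
noncomputable def picardTerm (A : ℝ → 𝔸) : ℕ → ℝ → 𝔸
  | 0, _ => 1
  | k + 1, t => ∫ s in (0 : ℝ)..t, A s * picardTerm A k s

theorem continuous_picardTerm {A : ℝ → 𝔸} (hA : Continuous A) (k : ℕ) :
    Continuous (picardTerm A k) := by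
  induction k with
  | zero => exact continuous_const
  | succ k ih =>
    have : Continuous fun s => A s * picardTerm A k s := hA.mul ih
    exact intervalIntegral.continuous_primitive (fun a b => this.intervalIntegrable a b) 0

theorem hasDerivAt_picardTerm_succ [CompleteSpace 𝔸] {A : ℝ → 𝔸} (hA : Continuous A) (k : ℕ) (t : ℝ) :
    HasDerivAt (picardTerm A (k + 1)) (A t * picardTerm A k t) t := by
  have : Continuous fun s => A s * picardTerm A k s := hA.mul (continuous_picardTerm hA k)
  exact intervalIntegral.integral_hasDerivAt_right (this.intervalIntegrable 0 t)
    (this.stronglyMeasurableAtFilter _ _) this.continuousAt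

/-- Each integration of `|s| ^ k` gains a factor `1 / (k + 1)`, so the series is dominated by an
exponential series on any bounded interval. -/
theorem norm_picardTerm_le {A : ℝ → 𝔸} (hA : Continuous A) {a K : ℝ} (hK : 0 ≤ K)
    (hAK : ∀ s, |s| < a → ‖A s‖ ≤ K) (k : ℕ) {t : ℝ} (ht : |t| < a) :
    ‖picardTerm A k t‖ ≤ ‖(1 : 𝔸)‖ * (K ^ k * |t| ^ k / k.factorial) := by
  induction k generalizing t with
  | zero => simp [picardTerm]
  | succ k ih =>
    have hc : Continuous fun s => A s * picardTerm A k s := hA.mul (continuous_picardTerm hA k)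
    calc ‖picardTerm A (k + 1) t‖
        ≤ ∫ s in Set.uIoc 0 t, ‖A s * picardTerm A k s‖ :=
          intervalIntegral.norm_integral_le_integral_norm_uIoc
      _ ≤ ∫ s in Set.uIoc 0 t, ‖(1 : 𝔸)‖ * (K ^ (k + 1) / k.factorial) * |s - 0| ^ k := by
          refine MeasureTheory.setIntegral_mono_on ?_ ?_ measurableSet_uIoc ?_
          · exact (hc.norm.intervalIntegrable 0 t).def'
          · refine (Continuous.intervalIntegrable ?_ 0 t).def'
            fun_prop
          · intro s hs
            have hs' : |s| < a := by
              refine lt_of_le_of_lt ?_ ht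
              rcases le_total 0 t with h0 | h0
              · rw [Set.uIoc_of_le h0] at hs
                rw [abs_of_pos hs.1, abs_of_nonneg h0]; exact hs.2
              · rw [Set.uIoc_of_ge h0] at hs
                rw [abs_of_nonpos hs.2, abs_of_nonpos h0]; linarith [hs.1]
            calc ‖A s * picardTerm A k s‖ ≤ ‖A s‖ * ‖picardTerm A k s‖ := norm_mul_le _ _
              _ ≤ K * (‖(1 : 𝔸)‖ * (K ^ k * |s| ^ k / k.factorial)) :=
                  mul_le_mul (hAK s hs') (ih hs') (norm_nonneg _) hK
              _ = _ := by rw [sub_zero]; ring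
      _ = _ := by
          rw [MeasureTheory.integral_const_mul, integral_pow_abs_sub_uIoc, sub_zero,
            Nat.factorial_succ]
          push_cast
          field_simp

theorem exists_linear_ode_solution [CompleteSpace 𝔸] {A : ℝ → 𝔸} (hA : Continuous A) :
    ∃ Φ : ℝ → 𝔸, Φ 0 = 1 ∧ ∀ t, HasDerivAt Φ (A t * Φ t) t := by
  refine ⟨fun t => ∑' k, picardTerm A k t, ?_, fun t => ?_⟩
  · refine (tsum_eq_single 0 ?_).trans rfl
    intro k hk
    obtain ⟨k, rfl⟩ := Nat.exists_eq_succ_of_ne_zero hk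
    simp [picardTerm]
  -- An open interval around both `0` and `t` on which `A` is bounded; the series is differentiated
  -- termwise there.
  · set a : ℝ := |t| + 1
    have ha : 0 < a := by positivity
    obtain ⟨K, hK⟩ := (isCompact_Icc (a := -a) (b := a)).exists_bound_of_continuousOn
      hA.continuousOn
    have hAK : ∀ s, |s| < a → ‖A s‖ ≤ K := fun s hs =>
      hK s ⟨(abs_lt.1 hs).1.le, (abs_lt.1 hs).2.le⟩
    have hK0 : 0 ≤ K := (norm_nonneg _).trans (hAK 0 (by simpa using ha))
    have hmem : ∀ y, y ∈ Set.Ioo (-a) a → |y| < a := fun y hy => abs_lt.2 hy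
    have hbound : ∀ k y, |y| < a →
        ‖picardTerm A k y‖ ≤ ‖(1 : 𝔸)‖ * ((K * a) ^ k / k.factorial) := by
      intro k y hy
      refine (norm_picardTerm_le hA hK0 hAK k hy).trans ?_
      rw [mul_pow]
      gcongr
    have hs : Summable fun k : ℕ => ‖(1 : 𝔸)‖ * ((K * a) ^ k / k.factorial) :=
      (Real.summable_pow_div_factorial (K * a)).mul_left _
    have hsum : ∀ y, |y| < a → Summable fun k => picardTerm A k y := fun y hy =>
      Summable.of_norm_bounded hs (fun k => hbound k y hy)
    have ht : |t| < a := by simp [a]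
    have h1 : HasDerivAt (fun z => ∑' k, picardTerm A (k + 1) z)
        (∑' k, A t * picardTerm A k t) t := by
      refine hasDerivAt_tsum_of_isPreconnected (u := fun k : ℕ =>
        K * (‖(1 : 𝔸)‖ * ((K * a) ^ k / k.factorial))) (hs.mul_left K) isOpen_Ioo
        isPreconnected_Ioo (t := Set.Ioo (-a) a) (y₀ := t)
        (fun k y _ => hasDerivAt_picardTerm_succ hA k y) ?_ (abs_lt.1 ht) ?_ (abs_lt.1 ht)
      · intro k y hy
        exact (norm_mul_le _ _).trans (mul_le_mul (hAK y (hmem y hy)) (hbound k y (hmem y hy))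
          (norm_nonneg _) hK0)
      · exact (summable_nat_add_iff 1).2 (hsum t ht)
    rw [(hsum t ht).tsum_mul_left] at h1
    have h2 : HasDerivAt (fun z => (1 : 𝔸) + ∑' k, picardTerm A (k + 1) z)
        (A t * ∑' k, picardTerm A k t) t := h1.const_add 1
    refine h2.congr_of_eventuallyEq ?_
    filter_upwards [isOpen_Ioo.mem_nhds (show t ∈ Set.Ioo (-a) a from abs_lt.1 ht)] with z hz
    rw [(hsum z (hmem z hz)).tsum_eq_zero_add]
    rfl

end LinearODE

/-! ### Fundamental matrices and their behaviour under a period -/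

section Fundamental

variable {n : ℕ} {t : ℝ} {F G : ℝ → Matrix (Fin n) (Fin n) ℝ} {F' G' : Matrix (Fin n) (Fin n) ℝ}

theorem hasDerivAt_matrix_mul (hF : HasDerivAt F F' t) (hG : HasDerivAt G G' t) :
    HasDerivAt (fun s => F s * G s) (F' * G t + F t * G') t := by
  -- Differentiability of matrix functions depends only on the topology, so a local choice of
  -- algebra norm gives access to calculus in normed algebras.
  let := Matrix.linftyOpNormedRing (n := Fin n) (α := ℝ)
  let := Matrix.linftyOpNormedAlgebra (n := Fin n) (R := ℝ) (α := ℝ)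
  exact hF.mul hG

theorem hasDerivAt_matrix_mul_const (hF : HasDerivAt F F' t) (P : Matrix (Fin n) (Fin n) ℝ) :
    HasDerivAt (fun s => F s * P) (F' * P) t := by
  let := Matrix.linftyOpNormedRing (n := Fin n) (α := ℝ)
  let := Matrix.linftyOpNormedAlgebra (n := Fin n) (R := ℝ) (α := ℝ)
  exact hF.mul_const P

theorem hasDerivAt_matrix_transpose (h : HasDerivAt F F' t) :
    HasDerivAt (fun s => (F s)ᵀ) F'ᵀ t := by
  let := Matrix.linftyOpNormedRing (n := Fin n) (α := ℝ)
  let := Matrix.linftyOpNormedAlgebra (n := Fin n) (R := ℝ) (α := ℝ)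
  let L : Matrix (Fin n) (Fin n) ℝ →L[ℝ] Matrix (Fin n) (Fin n) ℝ :=
    LinearMap.toContinuousLinearMap (Matrix.transposeLinearEquiv (Fin n) (Fin n) ℝ ℝ).toLinearMap
  exact L.hasFDerivAt.comp_hasDerivAt t h

theorem hasDerivAt_matrix_comp_add_const {T : ℝ} (h : HasDerivAt F F' (t + T)) :
    HasDerivAt (fun s => F (s + T)) F' t := by
  let := Matrix.linftyOpNormedRing (n := Fin n) (α := ℝ)
  let := Matrix.linftyOpNormedAlgebra (n := Fin n) (R := ℝ) (α := ℝ)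
  exact h.comp_add_const t T

theorem hasDerivAt_matrix_inv (hF : HasDerivAt F F' t) (hu : IsUnit (F t)) :
    HasDerivAt (fun s => (F s)⁻¹) (-((F t)⁻¹ * F' * (F t)⁻¹)) t := by
  let := Matrix.linftyOpNormedRing (n := Fin n) (α := ℝ)
  let := Matrix.linftyOpNormedAlgebra (n := Fin n) (R := ℝ) (α := ℝ)
  obtain ⟨u, hu⟩ := hu
  have h1 := hasFDerivAt_ringInverse (𝕜 := ℝ) u
  rw [hu] at h1
  have h2 := h1.comp_hasDerivAt t hF
  have h3 : (F t)⁻¹ = ↑u⁻¹ := by rw [← hu, Matrix.coe_units_inv]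
  rw [h3]
  have h4 : (fun s => (F s)⁻¹) = Ring.inverse ∘ F :=
    funext fun s => Matrix.nonsing_inv_eq_ringInverse _
  rw [h4]
  exact h2

theorem hasDerivAt_matrix_exp (R : Matrix (Fin n) (Fin n) ℝ) (t : ℝ) :
    HasDerivAt (fun s : ℝ => NormedSpace.exp (s • R)) (R * NormedSpace.exp (t • R)) t := by
  let := Matrix.linftyOpNormedRing (n := Fin n) (α := ℝ)
  let := Matrix.linftyOpNormedAlgebra (n := Fin n) (R := ℝ) (α := ℝ)
  exact hasDerivAt_exp_smul_const' R t

theorem eq_of_hasDerivAt_matrix_zero (hf : ∀ t, HasDerivAt F 0 t) (s t : ℝ) : F s = F t := by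
  let := Matrix.linftyOpNormedRing (n := Fin n) (α := ℝ)
  let := Matrix.linftyOpNormedAlgebra (n := Fin n) (R := ℝ) (α := ℝ)
  exact is_const_of_deriv_eq_zero (fun t => (hf t).differentiableAt) (fun t => (hf t).deriv) s t

theorem exists_matrix_ode_solution {A : ℝ → Matrix (Fin n) (Fin n) ℝ} (hA : Continuous A) :
    ∃ Φ : ℝ → Matrix (Fin n) (Fin n) ℝ, Φ 0 = 1 ∧ ∀ t, HasDerivAt Φ (A t * Φ t) t := by
  let := Matrix.linftyOpNormedRing (n := Fin n) (α := ℝ)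
  let := Matrix.linftyOpNormedAlgebra (n := Fin n) (R := ℝ) (α := ℝ)
  exact exists_linear_ode_solution hA

/-- Nonsingularity comes from the adjoint equation `Ψ' = -Aᵀ Ψ`: the product `Ψᵀ Φ` is constant,
equal to `1`, so `Ψᵀ` inverts `Φ`. -/
theorem exists_isFundamentalMatrix {A : ℝ → Matrix (Fin n) (Fin n) ℝ} (hA : Continuous A) :
    ∃ Φ, IsFundamentalMatrix A Φ := by
  obtain ⟨Φ, h0, h⟩ := exists_matrix_ode_solution hA
  obtain ⟨Ψ, h0', h'⟩ := exists_matrix_ode_solution (A := fun t => -(A t)ᵀ)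
    hA.matrix_transpose.neg
  refine ⟨Φ, h, fun t => ?_⟩
  have hd : ∀ t, HasDerivAt (fun s => (Ψ s)ᵀ * Φ s) 0 t := by
    intro t
    have e : (-(A t)ᵀ * Ψ t)ᵀ * Φ t + (Ψ t)ᵀ * (A t * Φ t) = 0 := by simp [Matrix.mul_assoc]
    exact e ▸ hasDerivAt_matrix_mul (hasDerivAt_matrix_transpose (h' t)) (h t)
  have := eq_of_hasDerivAt_matrix_zero hd t 0
  refine IsUnit.of_mul_eq_one_right (Ψ t)ᵀ ?_
  simpa [h0, h0'] using this

theorem IsFundamentalMatrix.add_period {A Φ : ℝ → Matrix (Fin n) (Fin n) ℝ} {T : ℝ}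
    (hΦ : IsFundamentalMatrix A Φ) (hper : Function.Periodic A T) (t : ℝ) :
    Φ (t + T) = Φ t * monodromy Φ T := by
  have hdet : ∀ t, IsUnit (Φ t).det := fun t => (Matrix.isUnit_iff_isUnit_det _).1 (hΦ.2 t)
  have hd : ∀ t, HasDerivAt (fun s => (Φ s)⁻¹ * Φ (s + T)) 0 t := by
    intro t
    have h1 : HasDerivAt (fun s => Φ (s + T)) (A t * Φ (t + T)) t := by
      have := hasDerivAt_matrix_comp_add_const (hΦ.1 (t + T))
      rwa [hper t] at this
    have e : -((Φ t)⁻¹ * (A t * Φ t) * (Φ t)⁻¹) * Φ (t + T) + (Φ t)⁻¹ * (A t * Φ (t + T)) = 0 := by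
      rw [Matrix.mul_assoc, Matrix.mul_assoc (A t), Matrix.mul_nonsing_inv _ (hdet t),
        Matrix.mul_one, Matrix.neg_mul, Matrix.mul_assoc, neg_add_cancel]
    exact e ▸ hasDerivAt_matrix_mul (hasDerivAt_matrix_inv (hΦ.1 t) (hΦ.2 t)) h1
  have := eq_of_hasDerivAt_matrix_zero hd t 0
  rw [zero_add] at this
  rw [monodromy, ← this, ← Matrix.mul_assoc, Matrix.mul_nonsing_inv _ (hdet t), Matrix.one_mul]

end Fundamental

/-! ### Powers and ranks of nilpotent shifts -/

section Shift

variable (K : Type*) [Field K]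

/-- The nilpotent matrix with `1` on the superdiagonal and `0` elsewhere. -/
def shift (m : ℕ) : Matrix (Fin m) (Fin m) K :=
  Matrix.of fun i j => if (i : ℕ) + 1 = (j : ℕ) then 1 else 0

variable {K}

theorem shift_apply (m : ℕ) (i j : Fin m) :
    shift K m i j = if (i : ℕ) + 1 = (j : ℕ) then 1 else 0 := rfl

theorem shift_pow_apply (m k : ℕ) (i j : Fin m) :
    (shift K m ^ k) i j = if (i : ℕ) + k = (j : ℕ) then 1 else 0 := by
  induction k generalizing i j with
  | zero => simp [Matrix.one_apply, Fin.ext_iff]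
  | succ k ih =>
    rw [pow_succ, Matrix.mul_apply]
    simp only [ih, shift_apply, ite_mul, one_mul, zero_mul]
    by_cases h : (i : ℕ) + k < m
    · rw [Finset.sum_eq_single ⟨i + k, h⟩]
      · simp [add_assoc]
      · intro b _ hb
        rw [if_neg]
        intro h'
        exact hb (Fin.ext h'.symm)
      · simp
    · have := j.isLt
      rw [Finset.sum_eq_zero, if_neg (by omega)]
      intro b _
      have := b.isLt
      rw [if_neg (by omega)]

theorem rank_shift_pow (m k : ℕ) : (shift K m ^ k).rank = m - k := by
  rcases le_total m k with h | h
  · have : shift K m ^ k = 0 := by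
      ext i j
      rw [shift_pow_apply, if_neg (by omega)]
      rfl
    rw [this, rank_zero]
    omega
  · obtain ⟨l, rfl⟩ := Nat.exists_eq_add_of_le h
    -- Rows are split as first `l`, last `k`; columns as last `l`, first `k`. The ones of the
    -- shifted diagonal then form an identity block.
    let e : Fin l ⊕ Fin k ≃ Fin (k + l) := finSumFinEquiv.trans (finCongr (add_comm _ _))
    let e' : Fin l ⊕ Fin k ≃ Fin (k + l) := (Equiv.sumComm _ _).trans finSumFinEquiv
    have : (shift K (k + l) ^ k).submatrix e e' =
        Matrix.fromBlocks (1 : Matrix (Fin l) (Fin l) K) 0 0 (0 : Matrix (Fin k) (Fin k) K) := by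
      ext i j
      rw [Matrix.submatrix_apply, shift_pow_apply]
      rcases i with i | i <;> rcases j with j | j
      · simp [e, e', Matrix.one_apply, Fin.ext_iff, add_comm]
      · have := j.isLt
        simp [e, e']
        omega
      · have := i.isLt
        simp [e, e']
        omega
      · have := j.isLt
        simp [e, e']
        omega
    rw [← rank_submatrix _ e e', this, rank_fromBlocks_diag, rank_one, rank_zero]
    simp

/-- Conjugation by a diagonal of powers of `c` rescales the superdiagonal. -/
theorem sim_smul_one_add_smul_shift (a : K) {c : K} (hc : c ≠ 0) (m : ℕ) :
    Sim (a • 1 + c • shift K m) (a • 1 + shift K m) := by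
  refine ⟨diagonal fun i => (c ^ (i : ℕ))⁻¹, diagonal fun i => c ^ (i : ℕ), ?_, ?_, ?_⟩
  · simp [hc]
  · simp [hc]
  · ext i j
    simp only [mul_diagonal, diagonal_mul, Matrix.add_apply, Matrix.smul_apply,
      Matrix.one_apply, shift_apply,
      smul_eq_mul]
    by_cases h1 : i = j
    · subst h1
      simp [mul_comm]
    · by_cases h2 : (i : ℕ) + 1 = j
      · simp only [h1, if_false, ← h2, if_true, pow_succ]
        field_simp
        ring
      · simp [h1, h2]

theorem rank_smul_one_add_shift_sub_pow (a c : K) [Decidable (a = c)] (m k : ℕ) :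
    ((a • 1 + shift K m - c • 1) ^ k).rank = if a = c then m - k else m := by
  split_ifs with h
  · subst h
    rw [add_sub_cancel_left, rank_shift_pow]
  · have hdet : (a • 1 + shift K m - c • 1).det ≠ 0 := by
      rw [det_of_isUpperTriangular]
      · simp [shift, sub_ne_zero, h]
      · intro i j hij
        simp only [id] at hij
        simp [shift, hij.ne']
        omega
    rw [rank_of_det_ne_zero, Fintype.card_fin]
    rw [det_pow]
    exact pow_ne_zero _ hdet

end Shift

/-! ### Block lists, uniqueness of multiplicities, conjugate symmetry -/

section JordanLists

theorem jordanBlock_eq (lam : ℂ) (m : ℕ) : jordanBlock lam m = lam • 1 + shift ℂ m := by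
  ext i j
  by_cases h : i = j
  · subst h
    simp [jordanBlock, shift]
  · simp [jordanBlock, shift, h]

theorem sim_blockDiagonal'_succ {k : ℕ} {m : Fin (k + 1) → ℕ}
    (B : ∀ i, Matrix (Fin (m i)) (Fin (m i)) ℂ) :
    Sim (blockDiagonal' B) (Matrix.fromBlocks (B 0) 0 0 (blockDiagonal' fun i : Fin k => B i.succ)) := by
  let f : (Fin (m 0) ⊕ Σ i : Fin k, Fin (m i.succ)) → Σ i, Fin (m i) :=
    Sum.elim (fun a => ⟨0, a⟩) (fun x => ⟨x.1.succ, x.2⟩)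
  have hf : Function.Bijective f := by
    constructor
    · rintro (a | ⟨i, a⟩) (b | ⟨j, b⟩) h
      · rw [eq_of_heq (Sigma.mk.inj h).2]
      · exact absurd (Sigma.mk.inj h).1 (Fin.succ_ne_zero _).symm
      · exact absurd (Sigma.mk.inj h).1 (Fin.succ_ne_zero _)
      · simp only [f, Sum.elim_inr, Sigma.mk.injEq] at h
        obtain ⟨h1, h2⟩ := h
        obtain rfl := Fin.succ_injective _ h1
        rw [eq_of_heq h2]
    · rintro ⟨i, a⟩
      refine Fin.cases (motive := fun i => ∀ a : Fin (m i), ∃ x, f x = ⟨i, a⟩)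
        (fun a => ⟨Sum.inl a, rfl⟩) (fun i a => ⟨Sum.inr ⟨i, a⟩, rfl⟩) i a
  have := Sim.submatrix (blockDiagonal' B) (Equiv.ofBijective f hf)
  convert this using 1
  ext x y
  rcases x with a | ⟨i, a⟩ <;> rcases y with b | ⟨j, b⟩
  · exact (Matrix.blockDiagonal'_apply_eq B 0 a b).symm
  · exact (Matrix.blockDiagonal'_apply_ne B (k := 0) (k' := j.succ) a b
      (Fin.succ_ne_zero _).symm).symm
  · exact (Matrix.blockDiagonal'_apply_ne B (k := i.succ) (k' := 0) a b (Fin.succ_ne_zero _)).symm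
  · by_cases h : i = j
    · subst h
      exact (Matrix.blockDiagonal'_apply_eq (fun i => B i.succ) i a b).trans
        (Matrix.blockDiagonal'_apply_eq B i.succ a b).symm
    · exact (Matrix.blockDiagonal'_apply_ne (fun i => B i.succ) a b h).trans
        (Matrix.blockDiagonal'_apply_ne B (k := i.succ) (k' := j.succ) a b
          fun h' => h (Fin.succ_injective _ h')).symm

theorem sim_jordanMatrix_cons (p : ℂ × ℕ) (J : List (ℂ × ℕ)) :
    Sim (jordanMatrix (p :: J))
      (Matrix.fromBlocks (jordanBlock p.1 p.2) 0 0 (jordanMatrix J)) :=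
  sim_blockDiagonal'_succ fun i : Fin (J.length + 1) =>
    jordanBlock ((p :: J).get i).1 ((p :: J).get i).2

instance isEmpty_jordanIndex_nil :
    IsEmpty (Σ i : Fin ([] : List (ℂ × ℕ)).length, Fin (([] : List (ℂ × ℕ)).get i).2) :=
  ⟨fun x => x.1.elim0⟩

theorem sim_jordanMatrix_append (J J' : List (ℂ × ℕ)) :
    Sim (jordanMatrix (J ++ J')) (Matrix.fromBlocks (jordanMatrix J) 0 0 (jordanMatrix J')) := by
  induction J with
  | nil => exact (Sim.fromBlocks_of_isEmpty _ _).symm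
  | cons p J ih =>
    refine (sim_jordanMatrix_cons p (J ++ J')).trans ?_
    refine ((Sim.refl _).fromBlocks ih).trans ?_
    exact (Sim.fromBlocks_assoc _ _ _).symm.trans
      ((sim_jordanMatrix_cons p J).symm.fromBlocks (Sim.refl _))

theorem sim_jordanMatrix_singleton (p : ℂ × ℕ) :
    Sim (jordanMatrix [p]) (jordanBlock p.1 p.2) :=
  (sim_jordanMatrix_cons p []).trans
    ((Sim.fromBlocks_comm _ _).trans (Sim.fromBlocks_of_isEmpty _ _))

theorem sim_jordanMatrix_of_perm {J J' : List (ℂ × ℕ)} (h : J.Perm J') :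
    Sim (jordanMatrix J) (jordanMatrix J') := by
  induction h with
  | nil => exact Sim.refl _
  | cons p _ ih =>
    exact (sim_jordanMatrix_cons p _).trans
      (((Sim.refl _).fromBlocks ih).trans (sim_jordanMatrix_cons p _).symm)
  | swap p q J =>
    refine ((sim_jordanMatrix_append [q, p] J).trans (Sim.fromBlocks ?_ (Sim.refl _))).trans
      (sim_jordanMatrix_append [p, q] J).symm
    exact ((sim_jordanMatrix_append [q] [p]).trans (Sim.fromBlocks_comm _ _)).trans
      (sim_jordanMatrix_append [p] [q]).symm
  | trans _ _ ih ih' => exact ih.trans ih'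

theorem rank_jordanMatrix_sub_pow (J : List (ℂ × ℕ)) (c : ℂ) (k : ℕ) :
    ((jordanMatrix J - c • 1) ^ k).rank =
      (J.map fun p => if p.1 = c then p.2 - k else p.2).sum := by
  induction J with
  | nil =>
    refine Nat.le_zero.1 ((rank_le_card_width _).trans ?_)
    simp
  | cons p J ih =>
    rw [((sim_jordanMatrix_cons p J).sub_smul_one_pow c k).rank_eq, ← fromBlocks_one,
      fromBlocks_smul, sub_eq_add_neg, fromBlocks_neg, fromBlocks_add]
    simp only [smul_zero, neg_zero, add_zero, ← sub_eq_add_neg]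
    rw [fromBlocks_diagonal_pow, rank_fromBlocks_diag, ih, List.map_cons, List.sum_cons,
      jordanBlock_eq, rank_smul_one_add_shift_sub_pow]

/-- The second difference of `k ↦ m - k` (truncated) is the indicator of `m = k + 1`. Combined with
`rank_jordanMatrix_sub_pow`, this recovers multiplicities from ranks. -/
theorem count_add_two_mul_sum (J : List (ℂ × ℕ)) (c : ℂ) (k : ℕ) :
    J.count (c, k + 1) + 2 * (J.map fun p => if p.1 = c then p.2 - (k + 1) else p.2).sum =
      (J.map fun p => if p.1 = c then p.2 - k else p.2).sum +
        (J.map fun p => if p.1 = c then p.2 - (k + 2) else p.2).sum := by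
  induction J with
  | nil => simp
  | cons p J ih =>
    obtain ⟨a, m⟩ := p
    simp only [List.map_cons, List.sum_cons, List.count_cons, beq_iff_eq, Prod.mk.injEq]
    by_cases h : a = c
    · by_cases h' : m = k + 1
      · simp only [h, h', and_self, if_true]
        omega
      · simp only [h, h', and_false, if_true, if_false]
        omega
    · simp only [h, false_and, if_false]
      omega

/-- Ranks of powers of `M - c` are similarity invariants and determine the multiplicities. Blocks of
size zero are invisible to them, hence the positivity condition. -/
theorem count_eq_of_sim {J J' : List (ℂ × ℕ)} (h : Sim (jordanMatrix J) (jordanMatrix J'))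
    {p : ℂ × ℕ} (hp : 0 < p.2) : J.count p = J'.count p := by
  obtain ⟨c, m⟩ := p
  obtain ⟨k, rfl⟩ := Nat.exists_eq_succ_of_ne_zero (Nat.pos_iff_ne_zero.1 hp)
  have hr : ∀ j, (J.map fun p => if p.1 = c then p.2 - j else p.2).sum =
      (J'.map fun p => if p.1 = c then p.2 - j else p.2).sum := fun j => by
    rw [← rank_jordanMatrix_sub_pow, ← rank_jordanMatrix_sub_pow,
      (h.sub_smul_one_pow c j).rank_eq]
  have h1 := count_add_two_mul_sum J c k
  have h2 := count_add_two_mul_sum J' c k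
  rw [hr, hr, hr] at h1
  simp only [Nat.succ_eq_add_one]
  omega

/-- Complex conjugation of the eigenvalue of a Jordan block. -/
noncomputable def conjBlock (p : ℂ × ℕ) : ℂ × ℕ := (star p.1, p.2)

theorem conjBlock_involutive : Function.Involutive conjBlock := fun p => by simp [conjBlock]

theorem jordanBlock_map_conj (c : ℂ) (m : ℕ) :
    (jordanBlock c m).map (starRingEnd ℂ) = jordanBlock (star c) m := by
  ext i j
  simp only [jordanBlock, map_apply, of_apply]
  split_ifs <;> simp

theorem sim_jordanMatrix_map_conj (J : List (ℂ × ℕ)) :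
    Sim ((jordanMatrix J).map (starRingEnd ℂ)) (jordanMatrix (J.map conjBlock)) := by
  induction J with
  | nil =>
    have : (jordanMatrix []).map (starRingEnd ℂ) = jordanMatrix [] := by
      ext i; exact i.1.elim0
    rw [this]
    exact Sim.refl _
  | cons p J ih =>
    refine ((sim_jordanMatrix_cons p J).map (starRingEnd ℂ)).trans ?_
    rw [fromBlocks_map, jordanBlock_map_conj]
    simp only [map_zero, Matrix.map_zero]
    exact ((Sim.refl _).fromBlocks ih).trans (sim_jordanMatrix_cons (conjBlock p) _).symm

/-- Nonreal Jordan blocks of a real matrix come in conjugate pairs. -/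
theorem count_conjBlock {ι : Type*} [Fintype ι] [DecidableEq ι] {M : Matrix ι ι ℝ}
    {J : List (ℂ × ℕ)} (h : Sim (M.map Complex.ofRealHom) (jordanMatrix J)) {p : ℂ × ℕ}
    (hp : 0 < p.2) : J.count (conjBlock p) = J.count p := by
  have h1 : (M.map Complex.ofRealHom).map (starRingEnd ℂ) = M.map Complex.ofRealHom := by
    ext i j
    simp
  have h2 := h.map (starRingEnd ℂ)
  rw [h1] at h2
  have h3 := count_eq_of_sim (h.symm.trans (h2.trans (sim_jordanMatrix_map_conj J)))
    (p := conjBlock p) hp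
  rw [h3]
  exact List.count_map_of_injective _ _ conjBlock_involutive.injective _

end JordanLists

/-! ### Descent of similarity from `ℂ` to `ℝ` -/

section RealDescent

variable {ι κ : Type*} [Fintype ι] [DecidableEq ι] [Fintype κ] [DecidableEq κ]

/-- If `P = A + iB` intertwines two real matrices, so do `A`, `B` and every `A + rB`. The polynomial
`det (A + X B)` is nonzero at `X = i`, hence nonzero at some real `r`. -/
theorem Sim.of_map_ofReal_aux {M N : Matrix ι ι ℝ}
    (h : Sim (M.map Complex.ofRealHom) (N.map Complex.ofRealHom)) : Sim M N := by
  obtain ⟨P, Q, h1, h2, h3⟩ := h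
  let A := P.map Complex.re
  let B := P.map Complex.im
  have hA : M * A = A * N := by
    ext i j
    have := congrArg Complex.re (congrFun (congrFun h3 i) j)
    simpa [A, Matrix.mul_apply] using this
  have hB : M * B = B * N := by
    ext i j
    have := congrArg Complex.im (congrFun (congrFun h3 i) j)
    simpa [B, Matrix.mul_apply] using this
  let D : Matrix ι ι (Polynomial ℝ) :=
    A.map Polynomial.C + (Polynomial.X : Polynomial ℝ) • B.map Polynomial.C
  have hD0 : D.det ≠ 0 := by
    intro h0
    have e : (Polynomial.eval₂RingHom Complex.ofRealHom Complex.I).mapMatrix D = P := by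
      ext i j
      change Polynomial.eval₂ Complex.ofRealHom Complex.I
        (Polynomial.C (P i j).re + Polynomial.X * Polynomial.C (P i j).im) = P i j
      rw [Polynomial.eval₂_add, Polynomial.eval₂_mul, Polynomial.eval₂_C, Polynomial.eval₂_C,
        Polynomial.eval₂_X, mul_comm]
      exact Complex.re_add_im _
    have := congrArg (Polynomial.eval₂RingHom Complex.ofRealHom Complex.I) h0
    rw [RingHom.map_det, e, map_zero] at this
    have hP : P.det * Q.det = 1 := by rw [← det_mul, h1, det_one]
    rw [this, zero_mul] at hP
    exact zero_ne_one hP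
  obtain ⟨r, hr⟩ : ∃ r, D.det.eval r ≠ 0 := by
    by_contra! hcon
    exact hD0 (Polynomial.funext fun r => by rw [hcon, Polynomial.eval_zero])
  have e : (Polynomial.evalRingHom r).mapMatrix D = A + r • B := by
    ext i j
    simp [D, mul_comm r]
  rw [← Polynomial.coe_evalRingHom, RingHom.map_det, e] at hr
  have hu : IsUnit (A + r • B).det := isUnit_iff_ne_zero.2 hr
  exact ⟨A + r • B, (A + r • B)⁻¹, mul_nonsing_inv _ hu, nonsing_inv_mul _ hu, by
    rw [Matrix.mul_add, Matrix.add_mul, hA, Matrix.mul_smul, hB, Matrix.smul_mul]⟩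

/-- Real matrices that are similar over `ℂ` are similar over `ℝ`. -/
theorem Sim.of_map_ofReal {M : Matrix ι ι ℝ} {N : Matrix κ κ ℝ}
    (h : Sim (M.map Complex.ofRealHom) (N.map Complex.ofRealHom)) : Sim M N := by
  let e : ι ≃ κ := Fintype.equivOfCardEq h.card_eq
  have h1 := Sim.submatrix N e
  exact (Sim.of_map_ofReal_aux (h.trans (h1.map Complex.ofRealHom))).trans h1.symm

end RealDescent

/-! ### Matrix exponentials: blocks, realification, local surjectivity -/

section MatrixExp

variable {𝕜 ι κ : Type*} [RCLike 𝕜] [Fintype ι] [DecidableEq ι] [Fintype κ] [DecidableEq κ]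

theorem map_matrix_exp {𝕜' : Type*} [RCLike 𝕜'] (f : Matrix ι ι 𝕜 →+* Matrix κ κ 𝕜')
    (hf : Continuous f) (X : Matrix ι ι 𝕜) :
    f (NormedSpace.exp X) = NormedSpace.exp (f X) := by
  let := Matrix.linftyOpNormedRing (n := ι) (α := 𝕜)
  let := Matrix.linftyOpNormedAlgebra (n := ι) (R := ℚ) (α := 𝕜)
  have : @CompleteSpace (Matrix ι ι 𝕜) PseudoMetricSpace.toUniformSpace :=
    inferInstanceAs (CompleteSpace (ι → ι → 𝕜))
  let := Matrix.linftyOpNormedRing (n := κ) (α := 𝕜')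
  exact NormedSpace.map_exp f hf X

theorem exp_submatrix (X : Matrix ι ι 𝕜) (e : κ ≃ ι) :
    NormedSpace.exp (X.submatrix e e) = (NormedSpace.exp X).submatrix e e :=
  (map_matrix_exp (Matrix.reindexRingEquiv 𝕜 e.symm).toRingHom
    (continuous_id.matrix_submatrix e e) X).symm

/-- The ring homomorphism `C ↦ [Re C, -Im C; Im C, Re C]`. -/
def realify (ι : Type*) [Fintype ι] [DecidableEq ι] :
    Matrix ι ι ℂ →+* Matrix (ι ⊕ ι) (ι ⊕ ι) ℝ where
  toFun C := fromBlocks (C.map Complex.re) (-(C.map Complex.im)) (C.map Complex.im)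
    (C.map Complex.re)
  map_one' := by
    rw [← fromBlocks_one]
    congr 1 <;> ext i j <;> simp [Matrix.one_apply, apply_ite Complex.re, apply_ite Complex.im]
  map_zero' := by
    rw [← fromBlocks_zero]
    congr 1 <;> (ext; simp)
  map_add' C D := by
    rw [fromBlocks_add]
    congr 1 <;> (ext; simp; ring)
  map_mul' C D := by
    rw [fromBlocks_multiply]
    congr 1 <;> ext i j <;>
      simp [Matrix.mul_apply, Finset.sum_add_distrib, sub_eq_add_neg, add_comm]

theorem continuous_realify : Continuous (realify ι) :=
  (continuous_id.matrix_map Complex.continuous_re).matrix_fromBlocks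
    (continuous_id.matrix_map Complex.continuous_im).neg
    (continuous_id.matrix_map Complex.continuous_im)
    (continuous_id.matrix_map Complex.continuous_re)

/-- The subspaces of vectors `(v, -iv)` and `(v, iv)` are invariant under the realification, which
acts on them as `C` and as its conjugate. -/
theorem sim_realify (C : Matrix ι ι ℂ) :
    Sim ((realify ι C).map Complex.ofRealHom)
      (fromBlocks C 0 0 (C.map (starRingEnd ℂ))) := by
  refine ⟨fromBlocks 1 1 (-Complex.I • 1) (Complex.I • 1),
    (1 / 2 : ℂ) • fromBlocks 1 (Complex.I • 1) 1 (-Complex.I • 1), ?_, ?_, ?_⟩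
  · rw [Matrix.mul_smul, fromBlocks_multiply, fromBlocks_smul, ← fromBlocks_one]
    congr 1 <;> ext i j <;> simp [Matrix.one_apply] <;> split_ifs <;> norm_num
  · rw [Matrix.smul_mul, fromBlocks_multiply, fromBlocks_smul, ← fromBlocks_one]
    congr 1 <;> ext i j <;> simp [Matrix.one_apply] <;> split_ifs <;> norm_num
  · change (fromBlocks _ _ _ _).map _ * _ = _
    rw [fromBlocks_map, fromBlocks_multiply, fromBlocks_multiply]
    congr 1 <;> ext i j <;> simp [Complex.ext_iff]

/-- The ring homomorphism `(X, Y) ↦ [X, 0; 0, Y]`. -/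
def fromBlocksHom (R ι κ : Type*) [CommRing R] [Fintype ι] [DecidableEq ι] [Fintype κ]
    [DecidableEq κ] : Matrix ι ι R × Matrix κ κ R →+* Matrix (ι ⊕ κ) (ι ⊕ κ) R where
  toFun p := fromBlocks p.1 0 0 p.2
  map_one' := fromBlocks_one
  map_zero' := fromBlocks_zero
  map_add' p q := by simp [fromBlocks_add]
  map_mul' p q := by simp [fromBlocks_multiply]

theorem exp_fromBlocks (X : Matrix ι ι 𝕜) (Y : Matrix κ κ 𝕜) :
    NormedSpace.exp (fromBlocks X 0 0 Y) =
      fromBlocks (NormedSpace.exp X) 0 0 (NormedSpace.exp Y) := by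
  let := Matrix.linftyOpNormedRing (n := ι) (α := 𝕜)
  let := Matrix.linftyOpNormedAlgebra (n := ι) (R := ℚ) (α := 𝕜)
  have : @CompleteSpace (Matrix ι ι 𝕜) PseudoMetricSpace.toUniformSpace :=
    inferInstanceAs (CompleteSpace (ι → ι → 𝕜))
  let := Matrix.linftyOpNormedRing (n := κ) (α := 𝕜)
  let := Matrix.linftyOpNormedAlgebra (n := κ) (R := ℚ) (α := 𝕜)
  have : @CompleteSpace (Matrix κ κ 𝕜) PseudoMetricSpace.toUniformSpace :=
    inferInstanceAs (CompleteSpace (κ → κ → 𝕜))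
  let := Matrix.linftyOpNormedRing (n := ι ⊕ κ) (α := 𝕜)
  have hc : Continuous (fromBlocksHom 𝕜 ι κ) :=
    continuous_fst.matrix_fromBlocks continuous_const continuous_const continuous_snd
  have h := NormedSpace.map_exp (fromBlocksHom 𝕜 ι κ) hc (X, Y)
  have h1 := Prod.fst_exp (X, Y)
  have h2 := Prod.snd_exp (X, Y)
  refine h.symm.trans ?_
  change fromBlocks _ 0 0 _ = _
  rw [h1, h2]
  rfl

/-- The derivative of `exp` at `0` is the identity, so its range is a neighbourhood of `1`. This
replaces a logarithm series: the factor `ε` is harmless for a shift, whose superdiagonal can be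
rescaled. -/
theorem exists_exp_eq_one_add_smul (N : Matrix ι ι 𝕜) :
    ∃ ε : 𝕜, ε ≠ 0 ∧ ∃ X : Matrix ι ι 𝕜, NormedSpace.exp X = 1 + ε • N := by
  let := Matrix.linftyOpNormedRing (n := ι) (α := 𝕜)
  let := Matrix.linftyOpNormedAlgebra (n := ι) (R := 𝕜) (α := 𝕜)
  have : @CompleteSpace (Matrix ι ι 𝕜) PseudoMetricSpace.toUniformSpace :=
    FiniteDimensional.complete 𝕜 _
  have h := hasStrictFDerivAt_exp_zero (𝕂 := 𝕜) (𝔸 := Matrix ι ι 𝕜)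
  have h1 := h.map_nhds_eq_of_surj (LinearMap.range_eq_top.2 fun x => ⟨x, rfl⟩)
  have h2 : Set.range (NormedSpace.exp : Matrix ι ι 𝕜 → Matrix ι ι 𝕜) ∈ nhds 1 := by
    rw [NormedSpace.exp_zero] at h1
    exact h1 ▸ Filter.range_mem_map
  have h3 : Filter.Tendsto (fun ε : 𝕜 => 1 + ε • N) (nhdsWithin 0 {0}ᶜ) (nhds 1) := by
    have : Continuous (fun ε : 𝕜 => 1 + ε • N) := by fun_prop
    have := (this.tendsto 0).mono_left (nhdsWithin_le_nhds (s := {0}ᶜ))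
    simpa using this
  obtain ⟨ε, hε, X, hX⟩ := ((eventually_nhdsWithin_of_forall fun ε hε => hε).and (h3 h2)).exists
  exact ⟨ε, hε, X, hX⟩

theorem exp_smul_one (a : 𝕜) :
    NormedSpace.exp (a • (1 : Matrix ι ι 𝕜)) = NormedSpace.exp a • (1 : Matrix ι ι 𝕜) := by
  rw [Matrix.smul_one_eq_diagonal, Matrix.smul_one_eq_diagonal, Matrix.exp_diagonal]
  congr 1
  funext i
  exact Pi.coe_exp (fun _ : ι => a) i

/-- A Jordan block with eigenvalue `c * exp a` is similar to `c • exp X` for some `X`. -/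
theorem exists_sim_smul_exp {c : 𝕜} (hc : c ≠ 0) (a : 𝕜) (m : ℕ) :
    ∃ X : Matrix (Fin m) (Fin m) 𝕜,
      Sim (c • NormedSpace.exp X) ((c * NormedSpace.exp a) • 1 + shift 𝕜 m) := by
  obtain ⟨ε, hε, X, hX⟩ := exists_exp_eq_one_add_smul (shift 𝕜 m)
  refine ⟨a • 1 + X, ?_⟩
  have hcomm : Commute (a • (1 : Matrix (Fin m) (Fin m) 𝕜)) X := (Commute.one_left X).smul_left a
  have ha : NormedSpace.exp a ≠ 0 := (NormedSpace.isUnit_exp a).ne_zero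
  have e : c • NormedSpace.exp (a • 1 + X) =
      (c * NormedSpace.exp a) • 1 + (c * NormedSpace.exp a * ε) • shift 𝕜 m := by
    rw [Matrix.exp_add_of_commute _ _ hcomm, exp_smul_one, hX]
    simp [mul_smul, smul_add]
  rw [e]
  exact sim_smul_one_add_smul_shift _ (mul_ne_zero (mul_ne_zero hc ha) hε) m

end MatrixExp

/-! ### Jordan blocks realized by real exponentials up to sign -/

section RealLog

/-- Some real matrix of the form `s • exp R` has the Jordan blocks in `J`. -/
def HasRealLog (s : ℝ) (J : List (ℂ × ℕ)) : Prop :=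
  ∃ (k : ℕ) (R : Matrix (Fin k) (Fin k) ℝ),
    Sim ((s • NormedSpace.exp R).map Complex.ofRealHom) (jordanMatrix J)

theorem HasRealLog.of_fintype {ι : Type*} [Fintype ι] [DecidableEq ι] {s : ℝ}
    {J : List (ℂ × ℕ)} (R : Matrix ι ι ℝ)
    (h : Sim ((s • NormedSpace.exp R).map Complex.ofRealHom) (jordanMatrix J)) :
    HasRealLog s J := by
  refine ⟨_, R.submatrix (Fintype.equivFin ι).symm (Fintype.equivFin ι).symm, ?_⟩
  rw [exp_submatrix]
  exact ((Sim.submatrix (s • NormedSpace.exp R) (Fintype.equivFin ι).symm).map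
    Complex.ofRealHom).symm.trans h

theorem HasRealLog.nil (s : ℝ) : HasRealLog s [] :=
  ⟨0, 0, by
    have := Sim.submatrix (jordanMatrix []) (Equiv.equivOfIsEmpty (Fin 0) _)
    convert this.symm using 1
    ext i
    exact i.elim0⟩

theorem HasRealLog.append {s : ℝ} {J J' : List (ℂ × ℕ)} (h : HasRealLog s J)
    (h' : HasRealLog s J') : HasRealLog s (J ++ J') := by
  obtain ⟨k, R, hR⟩ := h
  obtain ⟨k', R', hR'⟩ := h'
  refine HasRealLog.of_fintype (fromBlocks R 0 0 R') ?_
  rw [exp_fromBlocks, fromBlocks_smul, fromBlocks_map]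
  simp only [smul_zero, map_zero, Matrix.map_zero]
  exact (hR.fromBlocks hR').trans (sim_jordanMatrix_append J J').symm

theorem hasRealLog_singleton {s : ℝ} (hs : s ≠ 0) {x : ℝ} (hx : 0 < x) (m : ℕ) :
    HasRealLog s [(((s * x : ℝ) : ℂ), m)] := by
  obtain ⟨X, hX⟩ := exists_sim_smul_exp hs (Real.log x) m
  refine ⟨m, X, (hX.map Complex.ofRealHom).trans ?_⟩
  rw [← Real.exp_eq_exp_ℝ, Real.exp_log hx]
  refine Sim.trans ?_ (sim_jordanMatrix_singleton _).symm
  rw [jordanBlock_eq]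
  have e : ((s * x) • 1 + shift ℝ m).map Complex.ofRealHom =
      ((s * x : ℝ) : ℂ) • 1 + shift ℂ m := by
    ext i j
    simp [shift_apply, Matrix.one_apply, apply_ite Complex.ofReal]
  rw [e]
  exact Sim.refl _

/-- Realify a complex logarithm of one block. Real `c` is allowed; for negative `c` this absorbs two
equal blocks without a sign. -/
theorem hasRealLog_pair {c : ℂ} (hc : c ≠ 0) (m : ℕ) : HasRealLog 1 [(c, m), (star c, m)] := by
  obtain ⟨X, hX⟩ := exists_sim_smul_exp (one_ne_zero (α := ℂ)) (Complex.log c) m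
  rw [← Complex.exp_eq_exp_ℂ, Complex.exp_log hc, one_smul, one_mul, ← jordanBlock_eq] at hX
  refine HasRealLog.of_fintype (realify _ X) ?_
  rw [one_smul, ← map_matrix_exp _ continuous_realify]
  refine (sim_realify _).trans ((hX.fromBlocks (hX.map (starRingEnd ℂ))).trans ?_)
  rw [jordanBlock_map_conj]
  exact ((sim_jordanMatrix_singleton (c, m)).symm.fromBlocks
    (sim_jordanMatrix_singleton (star c, m)).symm).trans
    (sim_jordanMatrix_append [(c, m)] [(star c, m)]).symm

end RealLog

/-! ### Sorting the blocks: exponentials versus minus exponentials -/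

section OddNegative

/-- A common larger index set allows lists with different supports to be compared term by term. -/
theorem oddNegativeSize_eq_sum (J : List (ℂ × ℕ)) {S : Finset (ℂ × ℕ)} (hS : J.toFinset ⊆ S) :
    oddNegativeSize J =
      ∑ p ∈ S, if (p.1.im = 0 ∧ p.1.re < 0) ∧ Odd (J.count p) then p.2 else 0 := by
  rw [oddNegativeSize, Finset.sum_filter]
  refine Finset.sum_subset hS fun p _ hp => if_neg ?_
  rw [List.mem_toFinset] at hp
  simp [List.count_eq_zero_of_not_mem hp]

theorem oddNegativeSize_perm {J J' : List (ℂ × ℕ)} (h : J.Perm J') :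
    oddNegativeSize J = oddNegativeSize J' := by
  rw [oddNegativeSize, oddNegativeSize, List.toFinset_eq_of_perm _ _ h]
  simp only [h.count_eq]

theorem oddNegativeSize_cons_of_not_neg {p : ℂ × ℕ} (hp : ¬(p.1.im = 0 ∧ p.1.re < 0))
    (J : List (ℂ × ℕ)) : oddNegativeSize (p :: J) = oddNegativeSize J := by
  rw [oddNegativeSize_eq_sum (p :: J) subset_rfl,
    oddNegativeSize_eq_sum J (S := (p :: J).toFinset) (by
      rw [List.toFinset_cons]; exact Finset.subset_insert _ _)]
  refine Finset.sum_congr rfl fun q _ => ?_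
  by_cases h : p = q
  · subst h
    simp only [hp, false_and]
  · rw [List.count_cons_of_ne h]

theorem oddNegativeSize_cons_cons (p : ℂ × ℕ) (J : List (ℂ × ℕ)) :
    oddNegativeSize (p :: p :: J) = oddNegativeSize J := by
  rw [oddNegativeSize_eq_sum (p :: p :: J) subset_rfl,
    oddNegativeSize_eq_sum J (S := (p :: p :: J).toFinset) (by
      rw [List.toFinset_cons, List.toFinset_cons]
      exact (Finset.subset_insert _ _).trans (Finset.subset_insert _ _))]
  refine Finset.sum_congr rfl fun q _ => ?_
  by_cases h : p = q
  · subst h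
    simp only [List.count_cons_self, Nat.odd_add_one, not_not]
  · rw [List.count_cons_of_ne h, List.count_cons_of_ne h]

theorem oddNegativeSize_cons_of_notMem {p : ℂ × ℕ} (hp : p.1.im = 0 ∧ p.1.re < 0)
    {J : List (ℂ × ℕ)} (hJ : p ∉ J) :
    oddNegativeSize (p :: J) = p.2 + oddNegativeSize J := by
  rw [oddNegativeSize_eq_sum (p :: J) subset_rfl, oddNegativeSize_eq_sum J subset_rfl,
    List.toFinset_cons, Finset.sum_insert (by simpa using hJ)]
  congr 1
  · rw [List.count_cons_self, List.count_eq_zero_of_not_mem hJ]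
    simp [hp]
  · refine Finset.sum_congr rfl fun q hq => ?_
    rw [List.count_cons_of_ne]
    rintro rfl
    exact hJ (List.mem_toFinset.1 hq)

/-- The Jordan blocks of an invertible real matrix split into the blocks of the exponential of a
real matrix and those of minus such an exponential, the latter having total size
`oddNegativeSize`. -/
theorem exists_realLog_decomposition (J : List (ℂ × ℕ)) (hpos : ∀ p ∈ J, 0 < p.2)
    (hne : ∀ p ∈ J, p.1 ≠ 0) (hconj : ∀ p : ℂ × ℕ, 0 < p.2 → J.count (conjBlock p) = J.count p) :
    ∃ J₁ J₂ : List (ℂ × ℕ), J.Perm (J₁ ++ J₂) ∧ HasRealLog 1 J₁ ∧ HasRealLog (-1) J₂ ∧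
      (J₂.map Prod.snd).sum = oddNegativeSize J := by
  -- Strong induction on length, since a step removes either one block or a pair.
  induction hn : J.length using Nat.strong_induction_on generalizing J with
  | _ n ih =>
  subst hn
  rcases J with _ | ⟨p, J⟩
  · exact ⟨[], [], by simp, HasRealLog.nil _, HasRealLog.nil _, by simp [oddNegativeSize]⟩
  have hp0 : p.1 ≠ 0 := hne p (by simp)
  have hpp : 0 < p.2 := hpos p (by simp)
  by_cases him : p.1.im = 0
  · have hpc : conjBlock p = p := by
      refine Prod.ext ?_ rfl
      exact Complex.conj_eq_iff_im.2 him
    have hpe : p = ((p.1.re : ℂ), p.2) := Prod.ext (Complex.ext rfl (by simp [him])) rfl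
    have hconj' : ∀ q : ℂ × ℕ, 0 < q.2 → J.count (conjBlock q) = J.count q := by
      intro q hq
      have := hconj q hq
      simp only [List.count_cons, beq_iff_eq] at this
      have h : (p = conjBlock q) ↔ (p = q) := by
        rw [← conjBlock_involutive.injective.eq_iff (a := p), conjBlock_involutive, hpc]
      simpa only [h, Nat.add_right_cancel_iff] using this
    by_cases hre : p.1.re < 0
    · by_cases hmem : p ∈ J
      · obtain ⟨L, hL⟩ : ∃ L, J.Perm (p :: L) := ⟨_, List.perm_cons_erase hmem⟩
        have hsub : ∀ q ∈ L, q ∈ p :: J := fun q hq =>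
          List.mem_cons_of_mem _ (hL.mem_iff.2 (List.mem_cons_of_mem _ hq))
        obtain ⟨J₁, J₂, h1, h2, h3, h4⟩ := ih L.length
          (by rw [List.length_cons, hL.length_eq, List.length_cons]; omega) L
          (fun q hq => hpos q (hsub q hq)) (fun q hq => hne q (hsub q hq)) (by
            intro q hq
            have := hconj' q hq
            rw [hL.count_eq, hL.count_eq] at this
            simp only [List.count_cons, beq_iff_eq] at this
            have h : (p = conjBlock q) ↔ (p = q) := by
              rw [← conjBlock_involutive.injective.eq_iff (a := p), conjBlock_involutive, hpc]
            simpa only [h, Nat.add_right_cancel_iff] using this) rfl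
        -- Two equal negative blocks form a self-conjugate pair and leave all parities unchanged.
        refine ⟨[p, p] ++ J₁, J₂, ?_, ?_, h3, ?_⟩
        · exact (hL.cons p).trans ((h1.cons p).cons p)
        · refine HasRealLog.append ?_ h2
          have := hasRealLog_pair hp0 p.2
          have e : (star p.1, p.2) = p := hpc
          rwa [e] at this
        · rw [h4, oddNegativeSize_perm (hL.cons p), oddNegativeSize_cons_cons]
      · obtain ⟨J₁, J₂, h1, h2, h3, h4⟩ := ih J.length (by simp) J
          (fun q hq => hpos q (List.mem_cons_of_mem _ hq))
          (fun q hq => hne q (List.mem_cons_of_mem _ hq)) hconj' rfl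
        -- A negative block without a partner: the only case that feeds the `-exp` part.
        refine ⟨J₁, [p] ++ J₂, ?_, h2, ?_, ?_⟩
        · exact (h1.cons p).trans List.perm_middle.symm
        · refine HasRealLog.append ?_ h3
          have := hasRealLog_singleton (s := -1) (by norm_num) (neg_pos.2 hre) p.2
          rw [hpe]
          simpa using this
        · rw [oddNegativeSize_cons_of_notMem ⟨him, hre⟩ hmem, ← h4]
          simp
    · obtain ⟨J₁, J₂, h1, h2, h3, h4⟩ := ih J.length (by simp) J
        (fun q hq => hpos q (List.mem_cons_of_mem _ hq))
        (fun q hq => hne q (List.mem_cons_of_mem _ hq)) hconj' rfl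
      refine ⟨[p] ++ J₁, J₂, h1.cons p, ?_, h3, ?_⟩
      · refine HasRealLog.append ?_ h2
        have hre' : 0 < p.1.re := lt_of_le_of_ne (not_lt.1 hre) fun h =>
          hp0 (Complex.ext h.symm him)
        have := hasRealLog_singleton (s := 1) one_ne_zero hre' p.2
        rw [hpe]
        simpa using this
      · rw [h4, oddNegativeSize_cons_of_not_neg fun h => hre h.2]
  · have hne' : p ≠ conjBlock p := fun h => him (Complex.conj_eq_iff_im.1 (congrArg Prod.fst h).symm)
    have hmem : conjBlock p ∈ J := by
      have := hconj p hpp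
      rw [List.count_cons_self, List.count_cons_of_ne hne'] at this
      exact List.count_pos_iff.1 (by omega)
    obtain ⟨L, hL⟩ : ∃ L, J.Perm (conjBlock p :: L) := ⟨_, List.perm_cons_erase hmem⟩
    have hsub : ∀ q ∈ L, q ∈ p :: J := fun q hq =>
      List.mem_cons_of_mem _ (hL.mem_iff.2 (List.mem_cons_of_mem _ hq))
    obtain ⟨J₁, J₂, h1, h2, h3, h4⟩ := ih L.length
      (by rw [List.length_cons, hL.length_eq, List.length_cons]; omega) L
      (fun q hq => hpos q (hsub q hq)) (fun q hq => hne q (hsub q hq)) (by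
        intro q hq
        have := hconj q hq
        rw [(hL.cons p).count_eq, (hL.cons p).count_eq] at this
        simp only [List.count_cons, beq_iff_eq] at this
        have h : (p = conjBlock q) ↔ (conjBlock p = q) := by
          rw [← conjBlock_involutive.injective.eq_iff (a := p), conjBlock_involutive]
        have h' : (conjBlock p = conjBlock q) ↔ (p = q) :=
          conjBlock_involutive.injective.eq_iff
        simp only [h, h'] at this
        omega) rfl
    refine ⟨[p, conjBlock p] ++ J₁, J₂, ?_, ?_, h3, ?_⟩
    · exact (hL.cons p).trans ((h1.cons _).cons p)
    · exact HasRealLog.append (hasRealLog_pair hp0 p.2) h2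
    · rw [h4, oddNegativeSize_perm (hL.cons p), oddNegativeSize_cons_of_not_neg fun h => him h.1,
        oddNegativeSize_cons_of_not_neg]
      intro h
      exact him (by simpa [conjBlock] using h.1)

end OddNegative

/-! ### Existence of the Jordan normal form -/

section JordanExistence

open Polynomial in
theorem exists_jordan_basis_quotient (a : ℂ) (m : ℕ) (S : Submodule ℂ[X] ℂ[X])
    (hS : S = Ideal.span {(X - C a) ^ m}) :
    ∃ b : Module.Basis (Fin m) ℂ (ℂ[X] ⧸ S),
      ∀ j, (X : ℂ[X]) • b j = ∑ k, jordanBlock a m k j • b k := by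
  subst hS
  set I : Ideal ℂ[X] := Ideal.span {(X - C a) ^ m}
  let v : ℕ → ℂ[X] ⧸ I := fun k => Ideal.Quotient.mk I ((X - C a) ^ k)
  have hv : ∀ k, m ≤ k → v k = 0 := fun k hk =>
    Ideal.Quotient.eq_zero_iff_mem.2 (Ideal.mem_span_singleton.2 (pow_dvd_pow _ hk))
  have hX : ∀ k, (X : ℂ[X]) • v k = a • v k + v (k + 1) := by
    intro k
    have h1 : (X : ℂ[X]) • v k = Ideal.Quotient.mk I (X * (X - C a) ^ k) := rfl
    have h2 : a • v k = Ideal.Quotient.mk I (C a * (X - C a) ^ k) := by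
      rw [← smul_eq_C_mul]
      rfl
    rw [h1, h2]
    change _ = _ + Ideal.Quotient.mk I ((X - C a) ^ (k + 1))
    rw [← map_add]
    congr 1
    ring
  -- Powers of `X - a` in decreasing order, so that multiplication by `X` puts the ones above the
  -- diagonal; spanning follows from Taylor expansion at `a`.
  let w : Fin m → ℂ[X] ⧸ I := fun j => v (m - 1 - j)
  have hspan : ⊤ ≤ Submodule.span ℂ (Set.range w) := by
    rintro x -
    obtain ⟨f, rfl⟩ := Ideal.Quotient.mk_surjective x
    rw [← sum_taylor_eq f a, Polynomial.sum, map_sum]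
    refine Submodule.sum_mem _ fun k _ => ?_
    have h2 : Ideal.Quotient.mk I (C ((taylor a f).coeff k) * (X - C a) ^ k) =
        (taylor a f).coeff k • v k := by
      rw [← smul_eq_C_mul]
      rfl
    rw [h2]
    refine Submodule.smul_mem _ _ ?_
    by_cases hk : k < m
    · refine Submodule.subset_span ⟨⟨m - 1 - k, by omega⟩, ?_⟩
      simp only [w]
      congr 1
      omega
    · rw [hv k (by omega)]
      exact zero_mem _
  have hcard : Fintype.card (Fin m) = Module.finrank ℂ (ℂ[X] ⧸ I) := by
    rw [finrank_quotient_span_eq_natDegree, natDegree_pow, natDegree_X_sub_C, Fintype.card_fin,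
      mul_one]
  refine ⟨basisOfTopLeSpanOfCardEqFinrank w hspan hcard, fun j => ?_⟩
  simp only [coe_basisOfTopLeSpanOfCardEqFinrank]
  have h0 : ∀ k, jordanBlock a m k j • w k =
      (if k = j then a • w k else 0) + if (k : ℕ) + 1 = j then w k else 0 := by
    intro k
    simp only [jordanBlock, Matrix.of_apply]
    by_cases h1 : k = j
    · subst h1; simp
    · by_cases h2 : (k : ℕ) + 1 = j <;> simp [h1, h2]
  rw [Finset.sum_congr rfl fun k _ => h0 k, Finset.sum_add_distrib, Finset.sum_ite_eq' _ j,
    if_pos (Finset.mem_univ _), hX]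
  congr 1
  rcases Nat.eq_zero_or_pos (j : ℕ) with hj | hj
  · rw [hv _ (by omega), Finset.sum_eq_zero]
    intro k _
    rw [if_neg (by omega)]
  · have hjm := j.isLt
    rw [Finset.sum_eq_single ⟨j - 1, by omega⟩]
    · rw [if_pos (by simp only; omega)]
      simp only [w]
      congr 1
      omega
    · intro k _ hk
      rw [if_neg]
      intro h
      exact hk (Fin.ext (by simp only; omega))
    · simp

/-- With `X` acting as `M`, the space is a torsion `ℂ[X]`-module, hence a direct sum of quotients by
prime powers; the primes are linear over `ℂ`. -/
theorem exists_sim_blockDiagonal_jordanBlock {n : ℕ} (M : Matrix (Fin n) (Fin n) ℂ) :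
    ∃ (k : ℕ) (f : Fin k → ℂ × ℕ),
      Sim M (blockDiagonal' fun i => jordanBlock (f i).1 (f i).2) := by
  classical
  let φ : Module.End ℂ (Fin n → ℂ) := M.mulVecLin
  obtain ⟨ι, _, p, hp, m, ⟨E⟩⟩ := Module.equiv_directSum_of_isTorsion
    (Module.AEval.isTorsion_of_finiteDimensional ℂ (Fin n → ℂ) φ)
  have hex : ∀ i, ∃ a : ℂ, ∃ b : Module.Basis (Fin (m i)) ℂ (Polynomial ℂ ⧸
      Submodule.span (Polynomial ℂ) {p i ^ m i}),
      ∀ j, (Polynomial.X : Polynomial ℂ) • b j = ∑ k, jordanBlock a (m i) k j • b k := by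
    intro i
    have hdeg := IsAlgClosed.degree_eq_one_of_irreducible ℂ (hp i)
    obtain ⟨a, ha⟩ := Polynomial.exists_root_of_degree_eq_one hdeg
    have hassoc : Associated (p i) (Polynomial.X - Polynomial.C a) :=
      ((Polynomial.irreducible_X_sub_C a).associated_of_dvd (hp i)
        (Polynomial.dvd_iff_isRoot.2 ha)).symm
    refine ⟨a, exists_jordan_basis_quotient a (m i) _ ?_⟩
    exact Ideal.span_singleton_eq_span_singleton.2 (hassoc.pow_pow)
  choose a b hb using hex
  let B : Module.Basis (Σ i, Fin (m i)) ℂ (Fin n → ℂ) :=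
    ((DFinsupp.basis b).map (E.restrictScalars ℂ).symm).map (Module.AEval'.of φ).symm
  have hB : ∀ i j, B ⟨i, j⟩ = (Module.AEval'.of φ).symm
      (E.symm (DirectSum.lof (Polynomial ℂ) ι
        (fun i => Polynomial ℂ ⧸ Submodule.span (Polynomial ℂ) {p i ^ m i}) i (b i j))) := by
    intro i j
    have : DFinsupp.basis b ⟨i, j⟩ = DFinsupp.single i (b i j) := by
      simp [DFinsupp.basis]
    simp only [B, Module.Basis.map_apply, this]
    rfl
  have hφ : ∀ i j, M *ᵥ B ⟨i, j⟩ = ∑ k, jordanBlock (a i) (m i) k j • B ⟨i, k⟩ := by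
    intro i j
    have h1 : M *ᵥ B ⟨i, j⟩ = (Module.AEval'.of φ).symm
        ((Polynomial.X : Polynomial ℂ) • Module.AEval'.of φ (B ⟨i, j⟩)) := by
      rw [Module.AEval'.X_smul_of]
      simp [φ]
    rw [h1, hB, LinearEquiv.apply_symm_apply, ← map_smul, ← map_smul, hb, map_sum, map_sum, map_sum]
    refine Finset.sum_congr rfl fun k _ => ?_
    rw [hB, ← map_smul (Module.AEval'.of φ).symm]
    congr 1
    exact (E.symm.toLinearMap ∘ₗ DirectSum.lof (Polynomial ℂ) ι
      (fun i => Polynomial ℂ ⧸ Submodule.span (Polynomial ℂ) {p i ^ m i}) i).map_smul_of_tower _ _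
  have hsim : Sim M (blockDiagonal' fun i => jordanBlock (a i) (m i)) := by
    refine ⟨(Pi.basisFun ℂ (Fin n)).toMatrix B, B.toMatrix (Pi.basisFun ℂ (Fin n)),
      Module.Basis.toMatrix_mul_toMatrix_flip _ _, Module.Basis.toMatrix_mul_toMatrix_flip _ _, ?_⟩
    ext r ⟨i, j⟩
    have h1 := congrFun (hφ i j) r
    rw [Matrix.mulVec, dotProduct] at h1
    simp only [Matrix.mul_apply, Module.Basis.toMatrix_apply, Pi.basisFun_repr]
    rw [h1, Fintype.sum_sigma, Finset.sum_eq_single i]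
    · simp [blockDiagonal'_apply_eq, mul_comm]
    · intro i' _ hi'
      refine Finset.sum_eq_zero fun k _ => ?_
      rw [blockDiagonal'_apply_ne _ _ _ hi', mul_zero]
    · simp
  let σ : Fin (Fintype.card ι) ≃ ι := (Fintype.equivFin ι).symm
  refine ⟨_, fun i => (a (σ i), m (σ i)), hsim.trans ?_⟩
  have := Sim.submatrix (blockDiagonal' fun i => jordanBlock (a i) (m i))
    (Equiv.sigmaCongrLeft (β := fun i => Fin (m i)) σ)
  convert this using 1
  ext ⟨i, x⟩ ⟨j, y⟩
  by_cases h : i = j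
  · subst h
    exact (blockDiagonal'_apply_eq _ _ _ _).trans
      (blockDiagonal'_apply_eq (fun i => jordanBlock (a i) (m i)) (σ i) x y).symm
  · exact (blockDiagonal'_apply_ne _ _ _ h).trans
      (blockDiagonal'_apply_ne (fun i => jordanBlock (a i) (m i)) (k := σ i) (k' := σ j) x y
        fun h' => h (σ.injective h')).symm

/-- The structure theorem may produce exponents equal to zero; these empty blocks are discarded
here. -/
theorem exists_sim_jordanMatrix {k : ℕ} (f : Fin k → ℂ × ℕ) :
    ∃ J : List (ℂ × ℕ), (∀ p ∈ J, 0 < p.2) ∧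
      Sim (blockDiagonal' fun i => jordanBlock (f i).1 (f i).2) (jordanMatrix J) := by
  induction k with
  | zero =>
    refine ⟨[], by simp, ?_⟩
    have := Sim.submatrix (jordanMatrix []) (Equiv.equivOfIsEmpty (Σ i : Fin 0, Fin (f i).2) _)
    convert this.symm using 1
    ext i
    exact i.1.elim0
  | succ k ih =>
    obtain ⟨J, hJ, hs⟩ := ih fun i => f i.succ
    have h := sim_blockDiagonal'_succ fun i => jordanBlock (f i).1 (f i).2
    rcases Nat.eq_zero_or_pos (f 0).2 with h0 | h0
    · have : IsEmpty (Fin (f 0).2) := by rw [h0]; infer_instance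
      exact ⟨J, hJ, h.trans ((Sim.fromBlocks_of_isEmpty _ _).trans hs)⟩
    · refine ⟨f 0 :: J, ?_, h.trans (((Sim.refl _).fromBlocks hs).trans
        (sim_jordanMatrix_cons _ _).symm)⟩
      rintro p hp
      rcases List.mem_cons.1 hp with rfl | hp
      · exact h0
      · exact hJ p hp

theorem isJordanForm_iff_sim {n : ℕ} {M : Matrix (Fin n) (Fin n) ℂ} {J : List (ℂ × ℕ)} :
    IsJordanForm M J ↔ (∀ p ∈ J, 0 < p.2) ∧ Sim M (jordanMatrix J) := by
  refine and_congr_right fun _ => ⟨?_, fun h => ?_⟩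
  · rintro ⟨e, P, hP, h⟩
    have hP' := (Matrix.isUnit_iff_isUnit_det _).1 hP
    refine Sim.trans ⟨P, P⁻¹, mul_nonsing_inv _ hP', nonsing_inv_mul _ hP', ?_⟩
      (Sim.reindex (jordanMatrix J) e).symm
    rw [h, Matrix.mul_assoc, nonsing_inv_mul _ hP', Matrix.mul_one]
  · let e := (Fintype.equivOfCardEq h.card_eq).symm
    obtain ⟨P, Q, h1, h2, h3⟩ := h.trans (Sim.reindex (jordanMatrix J) e)
    refine ⟨e, P, IsUnit.of_mul_eq_one Q h1, ?_⟩
    rw [← h3, Matrix.mul_assoc, Matrix.inv_eq_right_inv h1, h1, Matrix.mul_one]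

/-- Every complex matrix has a Jordan normal form. -/
theorem exists_isJordanForm {n : ℕ} (M : Matrix (Fin n) (Fin n) ℂ) : ∃ J, IsJordanForm M J := by
  obtain ⟨k, f, h⟩ := exists_sim_blockDiagonal_jordanBlock M
  obtain ⟨J, hJ, h'⟩ := exists_sim_jordanMatrix f
  exact ⟨J, isJordanForm_iff_sim.2 ⟨hJ, h.trans h'⟩⟩

end JordanExistence

/-! ### Signed real logarithm of an invertible real matrix -/

section RealMonodromy

theorem card_jordanIndex (J : List (ℂ × ℕ)) :
    Fintype.card (Σ i : Fin J.length, Fin (J.get i).2) = (J.map Prod.snd).sum := by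
  induction J with
  | nil => simp
  | cons p J ih =>
    rw [(sim_jordanMatrix_cons p J).card_eq, Fintype.card_sum, ih, Fintype.card_fin]
    simp

theorem ne_zero_of_isUnit_jordanMatrix {J : List (ℂ × ℕ)} (hJ : IsUnit (jordanMatrix J))
    {p : ℂ × ℕ} (hp : p ∈ J) (hpos : 0 < p.2) : p.1 ≠ 0 := by
  intro h0
  have h := ((sim_jordanMatrix_of_perm (List.perm_cons_erase hp)).trans
    (sim_jordanMatrix_cons _ _)).isUnit hJ
  rw [Matrix.isUnit_iff_isUnit_det, det_fromBlocks_zero₂₁] at h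
  -- The last row of a nilpotent Jordan block vanishes.
  refine (isUnit_of_mul_isUnit_left h).ne_zero (det_eq_zero_of_row_eq_zero ⟨p.2 - 1, by omega⟩ ?_)
  intro j
  have := j.isLt
  simp only [jordanBlock, of_apply, h0]
  split_ifs
  · rfl
  · omega
  · rfl

theorem signMatrix_eq {n d : ℕ} (hd : d ≤ n) :
    signMatrix hd = (fromBlocks (1 : Matrix (Fin (n - d)) (Fin (n - d)) ℝ) 0 0
      (-1 : Matrix (Fin d) (Fin d) ℝ)).submatrix
        (finSumFinEquiv.trans (finCongr (Nat.sub_add_cancel hd))).symm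
        (finSumFinEquiv.trans (finCongr (Nat.sub_add_cancel hd))).symm := rfl

theorem exists_signed_exp_of_sim {n d : ℕ} (hd : d ≤ n) {M : Matrix (Fin n) (Fin n) ℝ}
    (R₁ : Matrix (Fin (n - d)) (Fin (n - d)) ℝ) (R₂ : Matrix (Fin d) (Fin d) ℝ)
    (h : Sim M (fromBlocks ((1 : ℝ) • NormedSpace.exp R₁) 0 0 ((-1 : ℝ) • NormedSpace.exp R₂))) :
    ∃ R P : Matrix (Fin n) (Fin n) ℝ, IsUnit P ∧ Commute (signMatrix hd) R ∧
      M * P = P * (signMatrix hd * NormedSpace.exp R) := by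
  set e := (finSumFinEquiv.trans (finCongr (Nat.sub_add_cancel hd))).symm with he
  obtain ⟨P, Q, h1, -, h3⟩ := h.trans (Sim.submatrix _ e)
  refine ⟨(fromBlocks R₁ 0 0 R₂).submatrix e e, P, IsUnit.of_mul_eq_one Q h1, ?_, ?_⟩
  · rw [Commute, SemiconjBy, signMatrix_eq, ← he, submatrix_mul_equiv, submatrix_mul_equiv,
      fromBlocks_multiply, fromBlocks_multiply]
    simp
  · rw [h3, exp_submatrix, exp_fromBlocks, signMatrix_eq, ← he, submatrix_mul_equiv,
      fromBlocks_multiply]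
    simp

/-- An invertible real matrix is similar over `ℝ` to `(I ⊕ -I) * exp R`, the two factors commuting,
where the size of `-I` is the total size of the distinct Jordan blocks with negative eigenvalue and
odd multiplicity. -/
theorem exists_signed_exp {n : ℕ} {M : Matrix (Fin n) (Fin n) ℝ} (hM : IsUnit M)
    {J : List (ℂ × ℕ)} (hJ : IsJordanForm (M.map Complex.ofReal) J) :
    ∃ (hd : oddNegativeSize J ≤ n) (R P : Matrix (Fin n) (Fin n) ℝ), IsUnit P ∧
      Commute (signMatrix hd) R ∧ M * P = P * (signMatrix hd * NormedSpace.exp R) := by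
  obtain ⟨hpos, hsim⟩ := isJordanForm_iff_sim.1 hJ
  have hsim' : Sim (M.map Complex.ofRealHom) (jordanMatrix J) := hsim
  have hunit : IsUnit (jordanMatrix J) :=
    hsim'.isUnit (hM.map (Complex.ofRealHom.mapMatrix (m := Fin n)))
  obtain ⟨J₁, J₂, hperm, ⟨k₁, R₁, h₁⟩, ⟨k₂, R₂, h₂⟩, hsize⟩ :=
    exists_realLog_decomposition J hpos
      (fun p hp => ne_zero_of_isUnit_jordanMatrix hunit hp (hpos p hp))
      (fun p hp => count_conjBlock hsim' hp)
  have hs : Sim M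
      (fromBlocks ((1 : ℝ) • NormedSpace.exp R₁) 0 0 ((-1 : ℝ) • NormedSpace.exp R₂)) := by
    refine Sim.of_map_ofReal ?_
    rw [fromBlocks_map]
    simp only [map_zero, Matrix.map_zero]
    exact hsim'.trans ((sim_jordanMatrix_of_perm hperm).trans
      ((sim_jordanMatrix_append _ _).trans (h₁.symm.fromBlocks h₂.symm)))
  -- Similar matrices have equal size, so the order of `R₂` is the total size of the blocks in `J₂`.
  have hk₂ : k₂ = oddNegativeSize J := by
    rw [← hsize, ← card_jordanIndex, ← h₂.card_eq, Fintype.card_fin]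
  have hn : n = k₁ + k₂ := by simpa using hs.card_eq
  obtain rfl : k₁ = n - oddNegativeSize J := by omega
  subst hk₂
  exact ⟨by omega, exists_signed_exp_of_sim _ R₁ R₂ hs⟩

end RealMonodromy

/-! ### Reduction to constant coefficients -/

section ChangeOfVariables

variable {n : ℕ} {t : ℝ}

theorem hasDerivAt_matrix_mulVec {F : ℝ → Matrix (Fin n) (Fin n) ℝ}
    {F' : Matrix (Fin n) (Fin n) ℝ} {x : ℝ → Fin n → ℝ} {x' : Fin n → ℝ}
    (hF : HasDerivAt F F' t) (hx : HasDerivAt x x' t) :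
    HasDerivAt (fun s => F s *ᵥ x s) (F' *ᵥ x t + F t *ᵥ x') t := by
  have hF' : ∀ i j, HasDerivAt (fun s => F s i j) (F' i j) t := by
    intro i j
    let := Matrix.linftyOpNormedRing (n := Fin n) (α := ℝ)
    let := Matrix.linftyOpNormedAlgebra (n := Fin n) (R := ℝ) (α := ℝ)
    let L : Matrix (Fin n) (Fin n) ℝ →L[ℝ] ℝ :=
      LinearMap.toContinuousLinearMap (Matrix.entryLinearMap ℝ ℝ i j)
    exact L.hasFDerivAt.comp_hasDerivAt t hF
  rw [hasDerivAt_pi] at hx ⊢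
  intro i
  have := HasDerivAt.fun_sum fun j (_ : j ∈ Finset.univ) => (hF' i j).mul (hx j)
  convert this using 1
  · rfl
  · exact (Finset.sum_add_distrib (s := Finset.univ) (f := fun j => F' i j * x t j)
      (g := fun j => F t i j * x' j)).symm

/-- If `Q' = A Q - Q R`, then `y = Q⁻¹ x` transforms `x' = A x` into `y' = R y`. -/
theorem hasDerivAt_iff_of_change_of_variables {A Q : ℝ → Matrix (Fin n) (Fin n) ℝ}
    {R : Matrix (Fin n) (Fin n) ℝ} (hQ : ∀ t, HasDerivAt Q (A t * Q t - Q t * R) t)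
    (hu : ∀ t, IsUnit (Q t)) (x : ℝ → Fin n → ℝ) (t : ℝ) :
    HasDerivAt x (A t *ᵥ x t) t ↔
      HasDerivAt (fun s => (Q s)⁻¹ *ᵥ x s) (R *ᵥ ((Q t)⁻¹ *ᵥ x t)) t := by
  have hdet : ∀ t, IsUnit (Q t).det := fun t => (Matrix.isUnit_iff_isUnit_det _).1 (hu t)
  constructor
  · intro h
    convert hasDerivAt_matrix_mulVec (hasDerivAt_matrix_inv (hQ t) (hu t)) h using 1
    have e : (Q t)⁻¹ * (A t * Q t - Q t * R) * (Q t)⁻¹ = (Q t)⁻¹ * A t - R * (Q t)⁻¹ := by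
      rw [Matrix.mul_sub, Matrix.sub_mul, nonsing_inv_mul_cancel_left _ _ (hdet t),
        ← Matrix.mul_assoc, mul_nonsing_inv_cancel_right _ _ (hdet t)]
    rw [e, mulVec_mulVec, mulVec_mulVec, neg_sub, sub_mulVec, sub_add_cancel]
  · intro h
    have hx : (fun s => Q s *ᵥ ((Q s)⁻¹ *ᵥ x s)) = x := by
      funext s
      rw [mulVec_mulVec, mul_nonsing_inv _ (hdet s), one_mulVec]
    have h2 := hasDerivAt_matrix_mulVec (hQ t) h
    rw [hx] at h2
    convert h2 using 1
    rw [mulVec_mulVec, mulVec_mulVec, mulVec_mulVec, ← add_mulVec, Matrix.sub_mul,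
      mul_nonsing_inv_cancel_right _ _ (hdet t), Matrix.mul_assoc, sub_add_cancel]

end ChangeOfVariables

theorem exists_isAIndex {n : ℕ} {A : ℝ → Matrix (Fin n) (Fin n) ℝ} (hA : Continuous A) (T : ℝ) :
    ∃ d, IsAIndex A T d := by
  obtain ⟨Φ, hΦ⟩ := exists_isFundamentalMatrix hA
  obtain ⟨J, hJ⟩ := exists_isJordanForm ((monodromy Φ T).map Complex.ofReal)
  exact ⟨_, Φ, J, hΦ, hJ, rfl⟩

theorem isAIndex_aIndex {n : ℕ} {A : ℝ → Matrix (Fin n) (Fin n) ℝ} (hA : Continuous A) (T : ℝ) :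
    IsAIndex A T (aIndex A T) := by
  have h := exists_isAIndex hA T
  rw [aIndex, dif_pos h]
  exact h.choose_spec

end Floquet

/-! ### The Floquet factorization -/

open Floquet in
theorem theoremA (n : ℕ) (T : ℝ) (hT : 0 < T) (A : ℝ → Matrix (Fin n) (Fin n) ℝ)
    (hA : Continuous A) (hper : Function.Periodic A T)
    (d : ℕ) (hd : d = Floquet.aIndex A T) :
    ∃ (hdn : d ≤ n) (R : Matrix (Fin n) (Fin n) ℝ) (Q : ℝ → Matrix (Fin n) (Fin n) ℝ),
      Floquet.IsFundamentalMatrix A (fun t => Q t * NormedSpace.exp (t • R)) ∧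
      (∀ t : ℝ, Q (t + T) = Q t * Floquet.signMatrix hdn) ∧
      (∀ t : ℝ, IsUnit (Q t)) ∧
      (∀ (x : ℝ → Fin n → ℝ) (t : ℝ),
        HasDerivAt x ((A t).mulVec (x t)) t ↔
          HasDerivAt (fun s => ((Q s)⁻¹).mulVec (x s)) (R.mulVec (((Q t)⁻¹).mulVec (x t))) t) := by
  -- The construction uses the very `Φ` and `J` that witness the index, so its independence of these
  -- choices is not needed.
  obtain ⟨Φ, J, hΦ, hJ, hdJ⟩ := isAIndex_aIndex hA T
  obtain rfl : d = oddNegativeSize J := hd.trans hdJ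
  have hM : IsUnit (monodromy Φ T) :=
    (Matrix.isUnit_nonsing_inv_iff.2 (hΦ.2 0)).mul (hΦ.2 T)
  obtain ⟨hdn, R', P, hP, hcomm, hMP⟩ := exists_signed_exp hM hJ
  set S := signMatrix hdn
  set R := T⁻¹ • R' with hR
  have hTR : T • R = R' := by rw [hR, smul_smul, mul_inv_cancel₀ hT.ne', one_smul]
  let E : ℝ → Matrix (Fin n) (Fin n) ℝ := fun t => NormedSpace.exp (t • R)
  let E' : ℝ → Matrix (Fin n) (Fin n) ℝ := fun t => NormedSpace.exp (t • -R)
  have hE'E : ∀ t, E' t * E t = 1 := by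
    intro t
    have hc : Commute (t • -R) (t • R) :=
      (((Commute.refl R).neg_left).smul_left t).smul_right t
    simp only [E, E']
    rw [← Matrix.exp_add_of_commute _ _ hc, smul_neg, neg_add_cancel, NormedSpace.exp_zero]
  have hE'u : ∀ t, IsUnit (E' t) := fun t => Matrix.isUnit_exp _
  have hRE' : ∀ t, R * E' t = E' t * R := fun t =>
    (((Commute.refl R).neg_right.smul_right t : Commute R (t • -R)).exp_right).eq
  -- `Φ P` is again fundamental, with monodromy `S * exp R'`; the factor `exp (-t R)` removes the
  -- exponential part.
  let Q : ℝ → Matrix (Fin n) (Fin n) ℝ := fun t => Φ t * P * E' t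
  have hQE : (fun t => Q t * NormedSpace.exp (t • R)) = fun t => Φ t * P := by
    funext t
    exact (Matrix.mul_assoc (Φ t * P) (E' t) (E t)).trans (by rw [hE'E, Matrix.mul_one])
  have hΦP : ∀ t, HasDerivAt (fun t => Φ t * P) (A t * (Φ t * P)) t := by
    intro t
    exact Matrix.mul_assoc (A t) (Φ t) P ▸ hasDerivAt_matrix_mul_const (hΦ.1 t) P
  have hQu : ∀ t, IsUnit (Q t) := fun t => ((hΦ.2 t).mul hP).mul (hE'u t)
  have hQ : ∀ t, HasDerivAt Q (A t * Q t - Q t * R) t := by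
    intro t
    have h := hasDerivAt_matrix_mul (hΦP t) (hasDerivAt_matrix_exp (-R) t)
    have e : A t * (Φ t * P) * NormedSpace.exp (t • -R) +
        Φ t * P * (-R * NormedSpace.exp (t • -R)) = A t * Q t - Q t * R := by
      have := hRE' t
      simp only [E'] at this
      simp only [Q, E']
      rw [Matrix.neg_mul, this, Matrix.mul_neg, ← sub_eq_add_neg]
      simp only [Matrix.mul_assoc]
    exact e ▸ h
  refine ⟨hdn, R, Q, ?_, ?_, hQu, hasDerivAt_iff_of_change_of_variables hQ hQu⟩
  · rw [hQE]
    exact ⟨hΦP, fun t => (hΦ.2 t).mul hP⟩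
  · intro t
    have hEadd : E' (t + T) = E' T * E' t := by
      have hc : Commute (T • -R) (t • -R) := ((Commute.refl (-R)).smul_left T).smul_right t
      simp only [E']
      rw [← Matrix.exp_add_of_commute _ _ hc, ← add_smul, add_comm T t]
    have hET : NormedSpace.exp R' * E' T = 1 := by
      rw [← hTR]
      exact mul_eq_one_comm.1 (hE'E T)
    have hSE : S * E' t = E' t * S := by
      have h1 : Commute S R := hcomm.smul_right T⁻¹
      exact ((h1.neg_right.smul_right t : Commute S (t • -R)).exp_right).eq
    calc Q (t + T) = Φ t * (monodromy Φ T * P) * (E' T * E' t) := by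
          simp only [Q]
          rw [hΦ.add_period hper, hEadd, Matrix.mul_assoc (Φ t)]
      _ = Φ t * P * S * (NormedSpace.exp R' * E' T) * E' t := by
          rw [hMP]
          simp only [Matrix.mul_assoc]
      _ = Φ t * P * (S * E' t) := by rw [hET, Matrix.mul_one, Matrix.mul_assoc]
      _ = Q t * S := by rw [hSE, ← Matrix.mul_assoc]
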